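/- For $k,n\ge 1$, a $k$-noncrossing tree with $n$ vertices is a tree on vertices $v_1,\dots,v_n$, placed in this order on a circle, whose edges, drawn as line segments, do not meet at interior points, together with a labelling of its vertices by labels in $\{1,\dots,k\}$ such that, whenever $v_i,v_j$ with $i<j$ are adjacent and the path from the root $v_1$ to $v_j$ contains $v_i$, the labels of $v_i$ and $v_j$ have sum at most $k+1$. Let $n>1$, choose a $2$-noncrossing tree with $n$ vertices uniformly at random, and let $X_1$ and $X_2$ be the numbers of its vertices labelled $1$ and $2$ respectively. Then $$\operatorname{Var}(X_1)=\operatorname{Var}(X_2)=\frac{3(2n-1)(4n-3)(49n^2-100n+44)}{25(5n-6)(7n-5)^2},$$ $$\operatorname{Cov}(X_1,X_2)=\operatorname{Cov}(X_2,X_1)=-\frac{3(2n-1)(4n-3)(49n^2-100n+44)}{25(5n-6)(7n-5)^2}.$$ -/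

import Mathlib

open MeasureTheory ProbabilityTheory

/-- A graph on the points `v₁, …, vₙ` placed on a circle in this order (the point `v_{i+1}` is
`i : Fin n`) is noncrossing if no two of its edges, drawn as chords, meet in interior points:
there are no `a < b < c < d` such that both `{a, c}` and `{b, d}` are edges. -/
def IsNoncrossing {n : ℕ} (G : SimpleGraph (Fin n)) : Prop :=
  ∀ a b c d : Fin n, a < b → b < c → c < d → ¬ (G.Adj a c ∧ G.Adj b d)

/-- A `k`-noncrossing tree with `n` vertices: a noncrossing tree on `v₁, …, vₙ`, rooted at `v₁`,
with labels in `{1, …, k}` such that adjacent vertices `vᵢ, vⱼ` with `i < j` have label sum at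
most `k + 1` whenever the path from the root to `vⱼ` contains `vᵢ`. -/
structure KNoncrossingTree (k n : ℕ) where
  graph : SimpleGraph (Fin n)
  isTree : graph.IsTree
  noncrossing : IsNoncrossing graph
  label : Fin n → Finset.Icc 1 k
  label_add_le : ∀ root i j : Fin n, (root : ℕ) = 0 → i < j → graph.Adj i j →
    (∃ p : graph.Walk root j, p.IsPath ∧ i ∈ p.support) →
    (label i : ℕ) + (label j : ℕ) ≤ k + 1

namespace KNoncrossingTree

/-- Every set of `k`-noncrossing trees with `n` vertices (a finite type) is measurable. -/
instance (k n : ℕ) : MeasurableSpace (KNoncrossingTree k n) := ⊤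

/-- The number of vertices labelled `h`, as a real random variable. -/
def labelCount {k n : ℕ} (h : ℕ) (T : KNoncrossingTree k n) : ℝ :=
  ((Finset.univ.filter fun v : Fin n => (T.label v : ℕ) = h).card : ℝ)

/-- The uniform distribution on the `k`-noncrossing trees with `n` vertices. -/
noncomputable def uniform (k n : ℕ) : Measure (KNoncrossingTree k n) :=
  uniformOn Set.univ

end KNoncrossingTree

/-!
A noncrossing tree on at least two consecutive integers `a, …, b` is cut, along the edge from `a` to
its largest neighbour `j`, into three noncrossing trees: one on `a, …, m`, one on `m + 1, …, j` and
one on `j, …, b`, where `a, …, m` is the component of `a` after deletion of the edge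
(`IsNCTree.exists_glue`, `IsNCTree.glue`, `glue_cut_unique`). The label condition splits
accordingly, the second and third part being rooted at `j` (`admissible_glue`). As the second
part has its root at the right end, trees rooted at either end have to be counted together; the
reflection `x ↦ -x` exchanges the two ends and, at the same time, the two directions of edges.

Let `X` mark edges and `u` mark the label `2`, and let `z` be the power series with
`z = X (1 + z) ^ 3 (1 + u z) ^ 2`. Not counting the label of the root, the trees rooted at the left
end have generating function `(1 + z) (1 + u z)` if the root has label `1` and `1 + z` if it has
label `2`, and those rooted at the right end have generating function `(1 + z) (1 + u z)` in either
case: these series satisfy the recurrence given by the decomposition (`treeWeight_eq_coeff`). Hence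
the `2`-noncrossing trees have generating function `(1 + z) (1 + u + u z)`, and Lagrange inversion
gives the total weight of the trees with `N + 2` vertices as `1 / (N + 1)` times the coefficient of
`X ^ N` in `(1 + 2 u + 2 u X) ((1 + X) ^ 3 (1 + u X) ^ 2) ^ (N + 1)`
(`treeWeight_eq_coeff_polynomial`).

With `u = 1 + v`, the coefficients of `1`, `v` and `v ^ 2` are the first binomial moments of `X₂`,
all of them rational multiples of the binomial coefficient `5N + 5` over `N`
(`coeff_momentPolynomial`). They give the variance of `X₂`; the other three values follow from
`X₁ = n - X₂`.
-/

/-! ### Noncrossing trees on integer intervals -/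

/-- Two points are linked by an edge set `E`, an edge being stored as the pair of its endpoints
in increasing order. -/
def Linked (E : Finset (ℤ × ℤ)) (x y : ℤ) : Prop := (x, y) ∈ E ∨ (y, x) ∈ E

/-- Two points are connected by a walk along the edge set `E`. -/
def Conn (E : Finset (ℤ × ℤ)) : ℤ → ℤ → Prop := Relation.ReflTransGen (Linked E)

/-- `E` is the edge set of a noncrossing tree on the integers `a, …, b`. Acyclicity is expressed
by the condition that every edge is a bridge. -/
structure IsNCTree (a b : ℤ) (E : Finset (ℤ × ℤ)) : Prop where
  le : a ≤ b
  bounds : ∀ p q, (p, q) ∈ E → a ≤ p ∧ p < q ∧ q ≤ b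
  cross : ∀ p q r s, (p, q) ∈ E → (r, s) ∈ E → p < r → r < q → ¬ q < s
  conn : ∀ x, a ≤ x → x ≤ b → Conn E a x
  bridge : ∀ p q, (p, q) ∈ E → ¬ Conn (E.erase (p, q)) p q

/-- The label condition for the tree `E` rooted at `r`, with `f` the set of vertices carrying the
large label: an edge `(p, q)`, `p < q`, directed away from the root upwards (if `s` is `true`)
or downwards (if `s` is `false`) does not have both endpoints in `f`. The endpoint nearer to the
root is the one still connected to the root after deletion of the edge. -/
def Admissible (s : Bool) (r : ℤ) (E : Finset (ℤ × ℤ)) (f : Finset ℤ) : Prop :=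
  ∀ p q, (p, q) ∈ E → Conn (E.erase (p, q)) r (if s then p else q) → ¬ (p ∈ f ∧ q ∈ f)

/-- The edge set glued from three edge sets and the edge from `a` to `j`. -/
def glue (a j : ℤ) (E₁ E₂ E₃ : Finset (ℤ × ℤ)) : Finset (ℤ × ℤ) :=
  insert (a, j) (E₁ ∪ E₂ ∪ E₃)

lemma mem_glue {a j : ℤ} {E₁ E₂ E₃ : Finset (ℤ × ℤ)} {e : ℤ × ℤ} :
    e ∈ glue a j E₁ E₂ E₃ ↔ e = (a, j) ∨ e ∈ E₁ ∨ e ∈ E₂ ∨ e ∈ E₃ := by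
  simp [glue]

lemma Linked.symm {E : Finset (ℤ × ℤ)} {x y : ℤ} (h : Linked E x y) : Linked E y x := Or.symm h

namespace Conn

variable {E E' : Finset (ℤ × ℤ)} {x y z : ℤ}

lemma refl (E : Finset (ℤ × ℤ)) (x : ℤ) : Conn E x x := Relation.ReflTransGen.refl

lemma trans (h : Conn E x y) (h' : Conn E y z) : Conn E x z := Relation.ReflTransGen.trans h h'

lemma symm (h : Conn E x y) : Conn E y x :=
  haveI : Std.Symm (Linked E) := ⟨fun _ _ => Linked.symm⟩
  Relation.ReflTransGen.stdSymm.symm _ _ h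

lemma of_mem (h : (x, y) ∈ E) : Conn E x y := Relation.ReflTransGen.single (Or.inl h)

/-- A map that sends every edge of `E` to an edge of `E'` or to a point sends connected points to
connected points. -/
lemma map (ρ : ℤ → ℤ) (hρ : ∀ p q, (p, q) ∈ E → ρ p = ρ q ∨ (ρ p, ρ q) ∈ E')
    (h : Conn E x y) : Conn E' (ρ x) (ρ y) := by
  induction h with
  | refl => exact refl _ _
  | tail _ hl ih =>
    refine ih.trans ?_
    rcases hl with hl | hl
    · rcases hρ _ _ hl with h | h
      · rw [h]; exact refl _ _
      · exact of_mem h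
    · rcases hρ _ _ hl with h | h
      · rw [h]; exact refl _ _
      · exact (of_mem h).symm

lemma mono (hE : E ⊆ E') (h : Conn E x y) : Conn E' x y :=
  h.map id fun _ _ hpq => Or.inr (hE hpq)

/-- A set that no edge leaves contains everything connected to one of its points. -/
lemma closed (S : ℤ → Prop) (hS : ∀ p q, (p, q) ∈ E → (S p ↔ S q)) (h : Conn E x y) (hx : S x) :
    S y := by
  induction h with
  | refl => exact hx
  | tail _ hl ih =>
    rcases hl with hl | hl
    · exact (hS _ _ hl).1 ih
    · exact (hS _ _ hl).2 ih

end Conn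

section Glue

variable {a m j b : ℤ} {E₁ E₂ E₃ : Finset (ℤ × ℤ)}

/-- The part of a glued edge set on `a, …, m` is a retract: the other vertices are contracted
to `a`. -/
lemma conn_retract_left (b₁ : ∀ p q, (p, q) ∈ E₁ → a ≤ p ∧ p < q ∧ q ≤ m)
    (b₂ : ∀ p q, (p, q) ∈ E₂ → m + 1 ≤ p ∧ p < q ∧ q ≤ j)
    (b₃ : ∀ p q, (p, q) ∈ E₃ → j ≤ p ∧ p < q ∧ q ≤ b) (ham : a ≤ m) (hmj : m + 1 ≤ j)
    {E : Finset (ℤ × ℤ)} (hE : E ⊆ glue a j E₁ E₂ E₃) {x y : ℤ} (h : Conn E x y) :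
    Conn (E₁ ∩ E) (if x ≤ m then x else a) (if y ≤ m then y else a) := by
  refine h.map (fun x => if x ≤ m then x else a) fun p q hpq => ?_
  obtain h | h | h | h := mem_glue.1 (hE hpq)
  · simp only [Prod.mk.injEq] at h
    left; split_ifs <;> omega
  · have := b₁ _ _ h
    rw [if_pos (by omega), if_pos (by omega)]
    exact Or.inr (Finset.mem_inter.2 ⟨h, hpq⟩)
  · have := b₂ _ _ h
    left; split_ifs <;> omega
  · have := b₃ _ _ h
    left; split_ifs <;> omega

/-- The part of a glued edge set on `m + 1, …, j` is a retract: the other vertices are contracted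
to `j`. -/
lemma conn_retract_middle (b₁ : ∀ p q, (p, q) ∈ E₁ → a ≤ p ∧ p < q ∧ q ≤ m)
    (b₂ : ∀ p q, (p, q) ∈ E₂ → m + 1 ≤ p ∧ p < q ∧ q ≤ j)
    (b₃ : ∀ p q, (p, q) ∈ E₃ → j ≤ p ∧ p < q ∧ q ≤ b) (ham : a ≤ m)
    {E : Finset (ℤ × ℤ)} (hE : E ⊆ glue a j E₁ E₂ E₃) {x y : ℤ} (h : Conn E x y) :
    Conn (E₂ ∩ E) (if m < x ∧ x ≤ j then x else j) (if m < y ∧ y ≤ j then y else j) := by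
  refine h.map (fun x => if m < x ∧ x ≤ j then x else j) fun p q hpq => ?_
  obtain h | h | h | h := mem_glue.1 (hE hpq)
  · simp only [Prod.mk.injEq] at h
    left; split_ifs <;> omega
  · have := b₁ _ _ h
    left; split_ifs <;> omega
  · have := b₂ _ _ h
    rw [if_pos (by omega), if_pos (by omega)]
    exact Or.inr (Finset.mem_inter.2 ⟨h, hpq⟩)
  · have := b₃ _ _ h
    left; split_ifs <;> omega

/-- The part of a glued edge set on `j, …, b` is a retract: the other vertices are contracted
to `j`. -/
lemma conn_retract_right (b₁ : ∀ p q, (p, q) ∈ E₁ → a ≤ p ∧ p < q ∧ q ≤ m)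
    (b₂ : ∀ p q, (p, q) ∈ E₂ → m + 1 ≤ p ∧ p < q ∧ q ≤ j)
    (b₃ : ∀ p q, (p, q) ∈ E₃ → j ≤ p ∧ p < q ∧ q ≤ b) (ham : a ≤ m) (hmj : m + 1 ≤ j)
    {E : Finset (ℤ × ℤ)} (hE : E ⊆ glue a j E₁ E₂ E₃) {x y : ℤ} (h : Conn E x y) :
    Conn (E₃ ∩ E) (if j ≤ x then x else j) (if j ≤ y then y else j) := by
  refine h.map (fun x => if j ≤ x then x else j) fun p q hpq => ?_
  obtain h | h | h | h := mem_glue.1 (hE hpq)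
  · simp only [Prod.mk.injEq] at h
    left; split_ifs <;> omega
  · have := b₁ _ _ h
    left; split_ifs <;> omega
  · have := b₂ _ _ h
    left; split_ifs <;> omega
  · have := b₃ _ _ h
    rw [if_pos (by omega), if_pos (by omega)]
    exact Or.inr (Finset.mem_inter.2 ⟨h, hpq⟩)

lemma inter_erase_subset {E F : Finset (ℤ × ℤ)} (e : ℤ × ℤ) : E ∩ F.erase e ⊆ E.erase e := by
  intro x hx
  rw [Finset.mem_inter, Finset.mem_erase] at hx
  exact Finset.mem_erase.2 ⟨hx.2.1, hx.1⟩

lemma conn_glue_erase_left (h₁ : IsNCTree a m E₁) (h₂ : IsNCTree (m + 1) j E₂)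
    (h₃ : IsNCTree j b E₃) {e : ℤ × ℤ} {x y : ℤ}
    (h : Conn ((glue a j E₁ E₂ E₃).erase e) x y) :
    Conn (E₁.erase e) (if x ≤ m then x else a) (if y ≤ m then y else a) :=
  (conn_retract_left h₁.bounds h₂.bounds h₃.bounds h₁.le h₂.le (Finset.erase_subset _ _) h).mono
    (inter_erase_subset e)

lemma conn_glue_erase_middle (h₁ : IsNCTree a m E₁) (h₂ : IsNCTree (m + 1) j E₂)
    (h₃ : IsNCTree j b E₃) {e : ℤ × ℤ} {x y : ℤ}
    (h : Conn ((glue a j E₁ E₂ E₃).erase e) x y) :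
    Conn (E₂.erase e) (if m < x ∧ x ≤ j then x else j) (if m < y ∧ y ≤ j then y else j) :=
  (conn_retract_middle h₁.bounds h₂.bounds h₃.bounds h₁.le (Finset.erase_subset _ _) h).mono
    (inter_erase_subset e)

lemma conn_glue_erase_right (h₁ : IsNCTree a m E₁) (h₂ : IsNCTree (m + 1) j E₂)
    (h₃ : IsNCTree j b E₃) {e : ℤ × ℤ} {x y : ℤ}
    (h : Conn ((glue a j E₁ E₂ E₃).erase e) x y) :
    Conn (E₃.erase e) (if j ≤ x then x else j) (if j ≤ y then y else j) :=
  (conn_retract_right h₁.bounds h₂.bounds h₃.bounds h₁.le h₂.le (Finset.erase_subset _ _) h).mono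
    (inter_erase_subset e)

/-- Without the edge from `a` to `j`, no edge of a glued tree joins `a, …, m` to the rest. -/
lemma conn_glue_erase_edge (h₁ : IsNCTree a m E₁) (h₂ : IsNCTree (m + 1) j E₂)
    (h₃ : IsNCTree j b E₃) {x : ℤ} (h : Conn ((glue a j E₁ E₂ E₃).erase (a, j)) a x) : x ≤ m := by
  refine h.closed (fun x => x ≤ m) (fun p q hpq => ?_) h₁.le
  rw [Finset.mem_erase, mem_glue] at hpq
  have := h₂.le
  obtain ⟨hne, h | h | h | h⟩ := hpq
  · exact absurd h hne
  · have := h₁.bounds _ _ h; constructor <;> intro <;> omega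
  · have := h₂.bounds _ _ h; constructor <;> intro <;> omega
  · have := h₃.bounds _ _ h; constructor <;> intro <;> omega

lemma subset_glue_left : E₁ ⊆ glue a j E₁ E₂ E₃ := fun _ h => mem_glue.2 (by tauto)
lemma subset_glue_middle : E₂ ⊆ glue a j E₁ E₂ E₃ := fun _ h => mem_glue.2 (by tauto)
lemma subset_glue_right : E₃ ⊆ glue a j E₁ E₂ E₃ := fun _ h => mem_glue.2 (by tauto)

lemma IsNCTree.conn' {a b : ℤ} {E : Finset (ℤ × ℤ)} (h : IsNCTree a b E) {x y : ℤ}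
    (hx : a ≤ x) (hx' : x ≤ b) (hy : a ≤ y) (hy' : y ≤ b) : Conn E x y :=
  (h.conn x hx hx').symm.trans (h.conn y hy hy')

theorem IsNCTree.glue (h₁ : IsNCTree a m E₁) (h₂ : IsNCTree (m + 1) j E₂)
    (h₃ : IsNCTree j b E₃) : IsNCTree a b (glue a j E₁ E₂ E₃) := by
  have l₁ := h₁.le
  have l₂ := h₂.le
  have l₃ := h₃.le
  refine ⟨by omega, ?_, ?_, ?_, ?_⟩
  · intro p q h
    rw [mem_glue] at h
    obtain h | h | h | h := h
    · simp only [Prod.mk.injEq] at h; omega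
    · have := h₁.bounds _ _ h; omega
    · have := h₂.bounds _ _ h; omega
    · have := h₃.bounds _ _ h; omega
  · intro p q r s h h' hpr hrq hqs
    rw [mem_glue] at h h'
    simp only [Prod.mk.injEq] at h h'
    obtain h | h | h | h := h <;> obtain h' | h' | h' | h' := h'
    · omega
    · have := h₁.bounds _ _ h'; omega
    · have := h₂.bounds _ _ h'; omega
    · have := h₃.bounds _ _ h'; omega
    · have := h₁.bounds _ _ h; omega
    · exact h₁.cross _ _ _ _ h h' hpr hrq hqs
    · have := h₁.bounds _ _ h; have := h₂.bounds _ _ h'; omega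
    · have := h₁.bounds _ _ h; have := h₃.bounds _ _ h'; omega
    · have := h₂.bounds _ _ h; omega
    · have := h₂.bounds _ _ h; have := h₁.bounds _ _ h'; omega
    · exact h₂.cross _ _ _ _ h h' hpr hrq hqs
    · have := h₂.bounds _ _ h; have := h₃.bounds _ _ h'; omega
    · have := h₃.bounds _ _ h; omega
    · have := h₃.bounds _ _ h; have := h₁.bounds _ _ h'; omega
    · have := h₃.bounds _ _ h; have := h₂.bounds _ _ h'; omega
    · exact h₃.cross _ _ _ _ h h' hpr hrq hqs
  · intro x hx hx'
    have haj : Conn (_root_.glue a j E₁ E₂ E₃) a j := Conn.of_mem (mem_glue.2 (Or.inl rfl))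
    by_cases c₁ : x ≤ m
    · exact (h₁.conn x hx c₁).mono subset_glue_left
    by_cases c₂ : x ≤ j
    · exact haj.trans ((h₂.conn' (by omega) (by omega) (by omega) c₂).mono subset_glue_middle)
    · exact haj.trans ((h₃.conn x (by omega) hx').mono subset_glue_right)
  · intro p q h hc
    have h' := h
    rw [mem_glue] at h
    obtain h | h | h | h := h
    · rw [h] at hc
      simp only [Prod.mk.injEq] at h
      rw [h.1, h.2] at hc
      have := conn_glue_erase_edge h₁ h₂ h₃ hc
      omega
    · have hb := h₁.bounds _ _ h
      have := conn_glue_erase_left h₁ h₂ h₃ hc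
      rw [if_pos (by omega), if_pos (by omega)] at this
      exact h₁.bridge _ _ h this
    · have hb := h₂.bounds _ _ h
      have := conn_glue_erase_middle h₁ h₂ h₃ hc
      rw [if_pos (by omega), if_pos (by omega)] at this
      exact h₂.bridge _ _ h this
    · have hb := h₃.bounds _ _ h
      have := conn_glue_erase_right h₁ h₂ h₃ hc
      rw [if_pos (by omega), if_pos (by omega)] at this
      exact h₃.bridge _ _ h this

/-- The label condition for a glued tree rooted at `a` splits into those for the three parts,
rooted at `a`, `j` and `j`, and the one for the edge from `a` to `j`, which is directed
upwards. -/
theorem admissible_glue (h₁ : IsNCTree a m E₁) (h₂ : IsNCTree (m + 1) j E₂)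
    (h₃ : IsNCTree j b E₃) (s : Bool) (f : Finset ℤ) :
    Admissible s a (glue a j E₁ E₂ E₃) f ↔
      Admissible s a E₁ f ∧ Admissible s j E₂ f ∧ Admissible s j E₃ f ∧
        (s = true → ¬ (a ∈ f ∧ j ∈ f)) := by
  have l₁ := h₁.le
  have l₂ := h₂.le
  have l₃ := h₃.le
  have key (e : ℤ × ℤ) (he : e ≠ (a, j)) : Conn ((glue a j E₁ E₂ E₃).erase e) a j :=
    Conn.of_mem (Finset.mem_erase.2 ⟨he.symm, mem_glue.2 (Or.inl rfl)⟩)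
  constructor
  · intro H
    refine ⟨?_, ?_, ?_, ?_⟩
    · intro p q h hc
      exact H p q (subset_glue_left h) (hc.mono (Finset.erase_subset_erase _ subset_glue_left))
    · intro p q h hc
      have hb := h₂.bounds _ _ h
      refine H p q (subset_glue_middle h) ((key _ ?_).trans
        (hc.mono (Finset.erase_subset_erase _ subset_glue_middle)))
      rw [Ne, Prod.mk.injEq]; omega
    · intro p q h hc
      have hb := h₃.bounds _ _ h
      refine H p q (subset_glue_right h) ((key _ ?_).trans
        (hc.mono (Finset.erase_subset_erase _ subset_glue_right)))
      rw [Ne, Prod.mk.injEq]; omega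
    · intro hs
      refine H a j (mem_glue.2 (Or.inl rfl)) ?_
      rw [hs]
      exact Conn.refl _ _
  · rintro ⟨H₁, H₂, H₃, H⟩ p q h hc
    rw [mem_glue] at h
    obtain h | h | h | h := h
    · rw [h] at hc
      simp only [Prod.mk.injEq] at h
      rw [h.1, h.2] at hc ⊢
      refine H ?_
      by_contra hs
      rw [if_neg hs] at hc
      have := conn_glue_erase_edge h₁ h₂ h₃ hc
      omega
    · have hb := h₁.bounds _ _ h
      have := conn_glue_erase_left h₁ h₂ h₃ hc
      rw [if_pos (by omega), if_pos (by split_ifs <;> omega)] at this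
      exact H₁ _ _ h this
    · have hb := h₂.bounds _ _ h
      have := conn_glue_erase_middle h₁ h₂ h₃ hc
      rw [if_neg (by omega), if_pos (by split_ifs <;> omega)] at this
      exact H₂ _ _ h this
    · have hb := h₃.bounds _ _ h
      have := conn_glue_erase_right h₁ h₂ h₃ hc
      rw [if_neg (by omega), if_pos (by split_ifs <;> omega)] at this
      exact H₃ _ _ h this

lemma Admissible.congr {a b : ℤ} {E : Finset (ℤ × ℤ)} (h : IsNCTree a b E) {s : Bool} {r : ℤ}
    {f g : Finset ℤ} (hfg : ∀ x, a ≤ x → x ≤ b → (x ∈ f ↔ x ∈ g)) (H : Admissible s r E f) :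
    Admissible s r E g := by
  intro p q hpq hc
  have hb := h.bounds _ _ hpq
  rw [← hfg p (by omega) (by omega), ← hfg q (by omega) (by omega)]
  exact H p q hpq hc

end Glue

/-- A glued tree determines the vertices `j` and `m` at which it is cut: `j` is the largest
neighbour of `a`, and `m` is the last vertex connected to `a` without the edge to `j`. -/
theorem glue_cut_unique {a b m j m' j' : ℤ} {E₁ E₂ E₃ E₁' E₂' E₃' : Finset (ℤ × ℤ)}
    (h₁ : IsNCTree a m E₁) (h₂ : IsNCTree (m + 1) j E₂) (h₃ : IsNCTree j b E₃)
    (h₁' : IsNCTree a m' E₁') (h₂' : IsNCTree (m' + 1) j' E₂') (h₃' : IsNCTree j' b E₃')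
    (h : glue a j E₁ E₂ E₃ = glue a j' E₁' E₂' E₃') : m = m' ∧ j = j' := by
  have aux {m j j' : ℤ} {E₁ E₂ E₃ E₁' E₂' E₃' : Finset (ℤ × ℤ)}
      (h₁ : IsNCTree a m E₁) (h₂ : IsNCTree (m + 1) j E₂) (h₃ : IsNCTree j b E₃)
      (h : glue a j E₁ E₂ E₃ = glue a j' E₁' E₂' E₃') : j' ≤ j := by
    have hm : (a, j') ∈ glue a j E₁ E₂ E₃ := h ▸ mem_glue.2 (Or.inl rfl)
    have l₁ := h₁.le
    have l₂ := h₂.le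
    rw [mem_glue] at hm
    obtain h | h | h | h := hm
    · simp only [Prod.mk.injEq] at h; omega
    · have := h₁.bounds _ _ h; omega
    · have := h₂.bounds _ _ h; omega
    · have := h₃.bounds _ _ h; omega
  have hj : j = j' := le_antisymm (aux h₁' h₂' h₃' h.symm) (aux h₁ h₂ h₃ h)
  subst hj
  have aux2 {m m' : ℤ} {E₁ E₂ E₃ E₁' E₂' E₃' : Finset (ℤ × ℤ)}
      (h₁ : IsNCTree a m E₁) (h₂ : IsNCTree (m + 1) j E₂) (h₃ : IsNCTree j b E₃)
      (h₁' : IsNCTree a m' E₁') (h₂' : IsNCTree (m' + 1) j E₂')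
      (h : glue a j E₁ E₂ E₃ = glue a j E₁' E₂' E₃') : m' ≤ m := by
    refine conn_glue_erase_edge h₁ h₂ h₃ (x := m') ?_
    rw [h]
    refine (h₁'.conn m' h₁'.le le_rfl).mono fun e he => ?_
    refine Finset.mem_erase.2 ⟨?_, subset_glue_left he⟩
    rintro rfl
    have := h₁'.bounds _ _ he
    have := h₂'.le
    omega
  exact ⟨le_antisymm (aux2 h₁' h₂' h₃' h₁ h₂ h.symm) (aux2 h₁ h₂ h₃ h₁' h₂' h), rfl⟩

lemma glue_filter_left {a b m j : ℤ} {E₁ E₂ E₃ : Finset (ℤ × ℤ)}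
    (h₁ : IsNCTree a m E₁) (h₂ : IsNCTree (m + 1) j E₂) (h₃ : IsNCTree j b E₃) :
    (glue a j E₁ E₂ E₃).filter (fun e => e.2 ≤ m) = E₁ := by
  have l₁ := h₁.le
  have l₂ := h₂.le
  ext ⟨p, q⟩
  rw [Finset.mem_filter, mem_glue, Prod.mk.injEq]
  constructor
  · rintro ⟨h | h | h | h, hq⟩
    · simp only at hq; omega
    · exact h
    · have := h₂.bounds _ _ h; simp only at hq; omega
    · have := h₃.bounds _ _ h; simp only at hq; omega
  · intro h
    exact ⟨by tauto, (h₁.bounds _ _ h).2.2⟩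

lemma glue_filter_middle {a b m j : ℤ} {E₁ E₂ E₃ : Finset (ℤ × ℤ)}
    (h₁ : IsNCTree a m E₁) (h₂ : IsNCTree (m + 1) j E₂) (h₃ : IsNCTree j b E₃) :
    (glue a j E₁ E₂ E₃).filter (fun e => m < e.1 ∧ e.2 ≤ j) = E₂ := by
  have l₁ := h₁.le
  have l₂ := h₂.le
  ext ⟨p, q⟩
  rw [Finset.mem_filter, mem_glue, Prod.mk.injEq]
  constructor
  · rintro ⟨h | h | h | h, hq⟩
    · simp only at hq; omega
    · have := h₁.bounds _ _ h; simp only at hq; omega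
    · exact h
    · have := h₃.bounds _ _ h; simp only at hq; omega
  · intro h
    have := h₂.bounds _ _ h
    exact ⟨by tauto, by simp only; omega⟩

lemma glue_filter_right {a b m j : ℤ} {E₁ E₂ E₃ : Finset (ℤ × ℤ)}
    (h₁ : IsNCTree a m E₁) (h₂ : IsNCTree (m + 1) j E₂) (h₃ : IsNCTree j b E₃) :
    (glue a j E₁ E₂ E₃).filter (fun e => j ≤ e.1) = E₃ := by
  have l₁ := h₁.le
  have l₂ := h₂.le
  ext ⟨p, q⟩
  rw [Finset.mem_filter, mem_glue, Prod.mk.injEq]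
  constructor
  · rintro ⟨h | h | h | h, hq⟩
    · simp only at hq; omega
    · have := h₁.bounds _ _ h; simp only at hq; omega
    · have := h₂.bounds _ _ h; simp only at hq; omega
    · exact h
  · intro h
    exact ⟨by tauto, (h₃.bounds _ _ h).1⟩

/-- Every noncrossing tree on at least two vertices is glued from three smaller ones, along the
edge from `a` to its largest neighbour `j`. -/
theorem IsNCTree.exists_glue {a b : ℤ} {E : Finset (ℤ × ℤ)} (h : IsNCTree a b E) (hab : a < b) :
    ∃ m j E₁ E₂ E₃, IsNCTree a m E₁ ∧ IsNCTree (m + 1) j E₂ ∧ IsNCTree j b E₃ ∧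
      E = _root_.glue a j E₁ E₂ E₃ := by
  classical
  -- the largest neighbour `j` of `a`
  have hne : (E.filter fun e => e.1 = a).Nonempty := by
    by_contra hemp
    rw [Finset.not_nonempty_iff_eq_empty, Finset.filter_eq_empty_iff] at hemp
    have := (h.conn b h.le le_rfl).closed (fun x => x = a) (fun p q hpq => by
      have h1 := hemp hpq
      have := h.bounds _ _ hpq
      simp only at h1
      constructor <;> intro <;> omega) rfl
    omega
  obtain ⟨⟨a', j⟩, hmem, hmax⟩ := Finset.exists_max_image _ (fun e : ℤ × ℤ => e.2) hne
  obtain ⟨haj, rfl⟩ : (a', j) ∈ E ∧ a' = a := by simpa using hmem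
  have hjmax : ∀ q, (a', q) ∈ E → q ≤ j := fun q hq => hmax (a', q) (by simpa using hq)
  have hbj := h.bounds _ _ haj
  have hsplit : ∀ p q, (p, q) ∈ E → p < j → q ≤ j := by
    intro p q hpq hpj
    by_contra hq
    rcases eq_or_ne p a' with rfl | hpa
    · exact hq (hjmax q hpq)
    · exact h.cross _ _ _ _ haj hpq (by have := h.bounds _ _ hpq; omega) hpj (by omega)
  -- the component `A` of `a` without the edge to `j`, and its last vertex `m`
  set A : ℤ → Prop := Conn (E.erase (a', j)) a' with hA
  have hAj : ¬ A j := h.bridge _ _ haj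
  have hAa : A a' := Conn.refl _ _
  have hAE : ∀ p q, (p, q) ∈ E → (p, q) ≠ (a', j) → (A p ↔ A q) := by
    intro p q hpq hpq'
    have := Conn.of_mem (Finset.mem_erase.2 ⟨hpq', hpq⟩)
    exact ⟨fun h => h.trans this, fun h => h.trans this.symm⟩
  have hAlt : ∀ x, A x → x < j := by
    intro x hx
    refine (hx.closed (fun x => A x ∧ x < j) (fun p q hpq => ?_) ⟨hAa, by omega⟩).2
    rw [Finset.mem_erase] at hpq
    have h1 := hAE p q hpq.2 hpq.1
    have h2 := h.bounds _ _ hpq.2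
    have h3 := hsplit p q hpq.2
    constructor
    · rintro ⟨h4, h5⟩
      have : q ≠ j := by rintro rfl; exact hAj (h1.1 h4)
      exact ⟨h1.1 h4, by have := h3 h5; omega⟩
    · rintro ⟨h4, h5⟩
      exact ⟨h1.2 h4, by omega⟩
  have hne' : ((Finset.Icc a' j).filter A).Nonempty :=
    ⟨a', Finset.mem_filter.2 ⟨Finset.mem_Icc.2 ⟨le_rfl, by omega⟩, hAa⟩⟩
  obtain ⟨m, hm, hmmax⟩ := Finset.exists_max_image _ (fun x : ℤ => x) hne'
  rw [Finset.mem_filter, Finset.mem_Icc] at hm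
  obtain ⟨⟨ham, -⟩, hAm⟩ := hm
  have hmj : m < j := hAlt m hAm
  have hAle : ∀ x, a' ≤ x → A x → x ≤ m := fun x hx hAx =>
    hmmax x (Finset.mem_filter.2 ⟨Finset.mem_Icc.2 ⟨hx, (hAlt x hAx).le⟩, hAx⟩)
  -- the component is an interval, since an edge passing over a vertex cannot be crossed
  have hAmem : ∀ x, a' ≤ x → x ≤ m → A x := by
    intro x hx hxm
    by_contra hAx
    have hxne : ∀ y, A y → y ≠ x := by rintro y hy rfl; exact hAx hy
    obtain ⟨p, q, hpq, hne, hAp, hpx, hxq⟩ :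
        ∃ p q, (p, q) ∈ E ∧ (p, q) ≠ (a', j) ∧ A p ∧ p < x ∧ x < q := by
      by_contra hcon
      push Not at hcon
      have := hAm.closed (fun y => A y ∧ y < x) (fun p q hpq => by
        rw [Finset.mem_erase] at hpq
        have h1 := hAE p q hpq.2 hpq.1
        have h2 := h.bounds _ _ hpq.2
        constructor
        · rintro ⟨h4, h5⟩
          have h6 := hcon p q hpq.2 hpq.1 h4 h5
          have h7 := hxne q (h1.1 h4)
          exact ⟨h1.1 h4, by omega⟩
        · rintro ⟨h4, h5⟩
          exact ⟨h1.2 h4, by omega⟩) ⟨hAa, by have := hxne a' hAa; omega⟩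
      omega
    have hAq := (hAE p q hpq hne).1 hAp
    have hqj := hAlt q hAq
    have := (h.conn' hx (by omega) hbj.2.1.le hbj.2.2).closed
      (fun y => (p < y ∧ y < q) ∧ ¬ A y) (fun r s hrs => by
        have hb := h.bounds _ _ hrs
        rcases eq_or_ne (r, s) (a', j) with he | he
        · simp only [Prod.mk.injEq] at he
          rw [he.1, he.2]
          constructor
          · rintro ⟨-, h5⟩; exact absurd hAa h5
          · rintro ⟨h5, -⟩; omega
        · have h1 := hAE r s hrs he
          constructor
          · rintro ⟨h4, h5⟩
            have h6 : ¬ A s := fun h => h5 (h1.2 h)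
            have h7 : s ≠ q := by rintro rfl; exact h6 hAq
            have h8 := h.cross p q r s hpq hrs h4.1 h4.2
            exact ⟨by omega, h6⟩
          · rintro ⟨h4, h5⟩
            have h6 : ¬ A r := fun h => h5 (h1.1 h)
            have h7 : r ≠ p := by rintro rfl; exact h6 hAp
            have h8 : p < r := by
              by_contra hlt
              exact h.cross r s p q hrs hpq (by omega) h4.1 h4.2
            exact ⟨by omega, h6⟩) ⟨⟨hpx, hxq⟩, hAx⟩
    omega
  have hb₁ : ∀ p q, (p, q) ∈ E.filter (fun e => e.2 ≤ m) → a' ≤ p ∧ p < q ∧ q ≤ m := by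
    intro p q hpq
    rw [Finset.mem_filter] at hpq
    have := h.bounds _ _ hpq.1
    exact ⟨this.1, this.2.1, hpq.2⟩
  have hb₂ : ∀ p q, (p, q) ∈ E.filter (fun e => m < e.1 ∧ e.2 ≤ j) →
      m + 1 ≤ p ∧ p < q ∧ q ≤ j := by
    intro p q hpq
    rw [Finset.mem_filter] at hpq
    have := h.bounds _ _ hpq.1
    exact ⟨hpq.2.1, this.2.1, hpq.2.2⟩
  have hb₃ : ∀ p q, (p, q) ∈ E.filter (fun e => j ≤ e.1) → j ≤ p ∧ p < q ∧ q ≤ b := by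
    intro p q hpq
    rw [Finset.mem_filter] at hpq
    have := h.bounds _ _ hpq.1
    exact ⟨hpq.2, this.2.1, this.2.2⟩
  have hglue : E = _root_.glue a' j (E.filter fun e => e.2 ≤ m)
      (E.filter fun e => m < e.1 ∧ e.2 ≤ j) (E.filter fun e => j ≤ e.1) := by
    ext ⟨p, q⟩
    simp only [mem_glue, Finset.mem_filter]
    constructor
    · intro hpq
      by_cases he : (p, q) = (a', j)
      · exact Or.inl he
      · have hb := h.bounds _ _ hpq
        have h1 := hAE p q hpq he
        right
        by_cases hjp : j ≤ p
        · tauto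
        · have h2 := hsplit p q hpq (by omega)
          by_cases hAp : A p
          · have := hAle q (by omega) (h1.1 hAp)
            tauto
          · have : m < p := by
              by_contra hlt
              exact hAp (hAmem p hb.1 (by omega))
            tauto
    · rintro (he | he | he | he)
      · rw [he]; exact haj
      all_goals exact he.1
  have hsub (P : ℤ × ℤ → Prop) [DecidablePred P] :
      (∀ p q r s, (p, q) ∈ E.filter P → (r, s) ∈ E.filter P → p < r → r < q → ¬ q < s) ∧
      (∀ p q, (p, q) ∈ E.filter P → ¬ Conn ((E.filter P).erase (p, q)) p q) :=
    ⟨fun p q r s h1 h2 => h.cross p q r s (Finset.mem_of_mem_filter _ h1)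
      (Finset.mem_of_mem_filter _ h2),
    fun p q h1 h2 => h.bridge p q (Finset.mem_of_mem_filter _ h1)
      (h2.mono (Finset.erase_subset_erase _ (Finset.filter_subset _ _)))⟩
  refine ⟨m, j, _, _, _, ⟨ham, hb₁, (hsub _).1, fun x hx hx' => ?_, (hsub _).2⟩,
    ⟨hmj, hb₂, (hsub _).1, fun x hx hx' => ?_, (hsub _).2⟩,
    ⟨hbj.2.2, hb₃, (hsub _).1, fun x hx hx' => ?_, (hsub _).2⟩, hglue⟩
  · have := conn_retract_left hb₁ hb₂ hb₃ ham hmj hglue.le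
      (h.conn' le_rfl h.le hx (by omega))
    rw [if_pos (by omega), if_pos (by omega)] at this
    exact this.mono Finset.inter_subset_left
  · have := conn_retract_middle hb₁ hb₂ hb₃ ham hglue.le
      (h.conn' (x := m + 1) (y := x) (by omega) (by omega) (by omega) (by omega))
    rw [if_pos (by omega), if_pos (by omega)] at this
    exact this.mono Finset.inter_subset_left
  · have := conn_retract_right hb₁ hb₂ hb₃ ham hmj hglue.le
      (h.conn' (x := j) (y := x) (by omega) (by omega) (by omega) (by omega))
    rw [if_pos (by omega), if_pos (by omega)] at this
    exact this.mono Finset.inter_subset_left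

/-! ### The recurrence for weighted counts -/

open Classical in
/-- The pairs `(E, f)` of a noncrossing tree `E` on `a, …, b` and a set `f` of vertices with the
large label which satisfy the label condition for the root `r`; the Boolean `c` says whether
the root lies in `f`. -/
noncomputable def configs (s : Bool) (a b r : ℤ) (c : Bool) :
    Finset (Finset (ℤ × ℤ) × Finset ℤ) :=
  ((Finset.Icc a b ×ˢ Finset.Icc a b).powerset ×ˢ (Finset.Icc a b).powerset).filter fun P =>
    IsNCTree a b P.1 ∧ Admissible s r P.1 P.2 ∧ (r ∈ P.2 ↔ c = true)

lemma mem_configs {s : Bool} {a b r : ℤ} {c : Bool} {E : Finset (ℤ × ℤ)} {f : Finset ℤ} :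
    (E, f) ∈ configs s a b r c ↔
      IsNCTree a b E ∧ f ⊆ Finset.Icc a b ∧ Admissible s r E f ∧ (r ∈ f ↔ c = true) := by
  simp only [configs, Finset.mem_filter, Finset.mem_product, Finset.mem_powerset]
  constructor
  · tauto
  · rintro ⟨h1, h2, h3, h4⟩
    refine ⟨⟨fun ⟨p, q⟩ hpq => ?_, h2⟩, h1, h3, h4⟩
    have := h1.bounds _ _ hpq
    simp only [Finset.mem_product, Finset.mem_Icc]
    omega

/-- The number of pairs in `configs s a b r c`, each counted with a factor `u` for every vertex
with the large label other than the root. -/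
noncomputable def treeWeight {K : Type*} [CommSemiring K] (u : K) (s : Bool) (a b r : ℤ)
    (c : Bool) : K :=
  ∑ P ∈ configs s a b r c, u ^ (P.2.erase r).card

section

variable {s c c' : Bool} {a b m j : ℤ} {E₁ E₂ E₃ : Finset (ℤ × ℤ)} {f₁ f₂ f₃ : Finset ℤ}

/-- The sets of large labels of the three parts agree at the shared vertex `j`, so each of them can
be read off from their union. -/
lemma mem_union_iff_of_left (h₂ : (E₂, f₂) ∈ configs s (m + 1) j j c')
    (h₃ : (E₃, f₃) ∈ configs s j b j c') {x : ℤ} (hx : x ≤ m) : x ∈ f₁ ∪ f₂ ∪ f₃ ↔ x ∈ f₁ := by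
  rw [mem_configs] at h₂ h₃
  have l₂ := h₂.1.le
  have g₂ : x ∉ f₂ := fun h => by have := Finset.mem_Icc.1 (h₂.2.1 h); omega
  have g₃ : x ∉ f₃ := fun h => by have := Finset.mem_Icc.1 (h₃.2.1 h); omega
  simp [g₂, g₃]

lemma mem_union_iff_of_middle (h₁ : (E₁, f₁) ∈ configs s a m a c)
    (h₂ : (E₂, f₂) ∈ configs s (m + 1) j j c') (h₃ : (E₃, f₃) ∈ configs s j b j c') {x : ℤ}
    (hx : m < x) (hx' : x ≤ j) : x ∈ f₁ ∪ f₂ ∪ f₃ ↔ x ∈ f₂ := by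
  rw [mem_configs] at h₁ h₂ h₃
  have g₁ : x ∉ f₁ := fun h => by have := Finset.mem_Icc.1 (h₁.2.1 h); omega
  rcases eq_or_lt_of_le hx' with rfl | hlt
  · simp only [Finset.mem_union, g₁, h₂.2.2.2, h₃.2.2.2]; tauto
  · have g₃ : x ∉ f₃ := fun h => by have := Finset.mem_Icc.1 (h₃.2.1 h); omega
    simp [g₁, g₃]

lemma mem_union_iff_of_right (h₁ : (E₁, f₁) ∈ configs s a m a c)
    (h₂ : (E₂, f₂) ∈ configs s (m + 1) j j c') (h₃ : (E₃, f₃) ∈ configs s j b j c') {x : ℤ}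
    (hx : j ≤ x) : x ∈ f₁ ∪ f₂ ∪ f₃ ↔ x ∈ f₃ := by
  rw [mem_configs] at h₁ h₂ h₃
  have l₂ := h₂.1.le
  have g₁ : x ∉ f₁ := fun h => by have := Finset.mem_Icc.1 (h₁.2.1 h); omega
  rcases eq_or_lt_of_le hx with rfl | hlt
  · simp only [Finset.mem_union, g₁, h₂.2.2.2, h₃.2.2.2]; tauto
  · have g₂ : x ∉ f₂ := fun h => by have := Finset.mem_Icc.1 (h₂.2.1 h); omega
    simp [g₁, g₂]

lemma glue_mem_configs (h₁ : (E₁, f₁) ∈ configs s a m a c)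
    (h₂ : (E₂, f₂) ∈ configs s (m + 1) j j c') (h₃ : (E₃, f₃) ∈ configs s j b j c')
    (hok : (s && c && c') = false) :
    (glue a j E₁ E₂ E₃, f₁ ∪ f₂ ∪ f₃) ∈ configs s a b a c := by
  have u₁ {x : ℤ} := mem_union_iff_of_left (f₁ := f₁) h₂ h₃ (x := x)
  have u₂ {x : ℤ} := mem_union_iff_of_middle h₁ h₂ h₃ (x := x)
  have u₃ {x : ℤ} := mem_union_iff_of_right h₁ h₂ h₃ (x := x)
  rw [mem_configs] at h₁ h₂ h₃
  obtain ⟨t₁, i₁, A₁, r₁⟩ := h₁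
  obtain ⟨t₂, i₂, A₂, r₂⟩ := h₂
  obtain ⟨t₃, i₃, A₃, r₃⟩ := h₃
  have l₁ := t₁.le
  have l₂ := t₂.le
  have l₃ := t₃.le
  rw [mem_configs, admissible_glue t₁ t₂ t₃, u₁ l₁, u₃ le_rfl, r₁, r₃]
  refine ⟨t₁.glue t₂ t₃, ?_, ⟨A₁.congr t₁ fun x _ h => (u₁ h).symm,
    A₂.congr t₂ fun x h h' => (u₂ (by omega) h').symm,
    A₃.congr t₃ fun x h _ => (u₃ h).symm, ?_⟩, Iff.rfl⟩
  · intro x hx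
    simp only [Finset.mem_union] at hx
    rw [Finset.mem_Icc]
    obtain (hx | hx) | hx := hx
    · have := Finset.mem_Icc.1 (i₁ hx); omega
    · have := Finset.mem_Icc.1 (i₂ hx); omega
    · have := Finset.mem_Icc.1 (i₃ hx); omega
  · rintro rfl ⟨rfl, rfl⟩
    exact absurd hok (by decide)

lemma card_erase_glue (h₁ : (E₁, f₁) ∈ configs s a m a c)
    (h₂ : (E₂, f₂) ∈ configs s (m + 1) j j c') (h₃ : (E₃, f₃) ∈ configs s j b j c') :
    ((f₁ ∪ f₂ ∪ f₃).erase a).card =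
      (f₁.erase a).card + ((f₂.erase j).card + (f₃.erase j).card) + c'.toNat := by
  rw [mem_configs] at h₁ h₂ h₃
  obtain ⟨t₁, i₁, A₁, r₁⟩ := h₁
  obtain ⟨t₂, i₂, A₂, r₂⟩ := h₂
  obtain ⟨t₃, i₃, A₃, r₃⟩ := h₃
  have l₁ := t₁.le
  have l₂ := t₂.le
  have l₃ := t₃.le
  have key : (f₁ ∪ f₂ ∪ f₃).erase a =
      f₁.erase a ∪ (f₂.erase j ∪ f₃.erase j) ∪ (if c' = true then {j} else ∅) := by
    ext x
    have k₂ : x ∈ f₂ → x ≠ a := fun h => by have := Finset.mem_Icc.1 (i₂ h); omega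
    have k₃ : x ∈ f₃ → x ≠ a := fun h => by have := Finset.mem_Icc.1 (i₃ h); omega
    rcases eq_or_ne x j with rfl | hxj
    · have : x ≠ a := by omega
      have k₁ : x ∉ f₁ := fun h => by have := Finset.mem_Icc.1 (i₁ h); omega
      cases c' <;> simp_all
    · cases c' <;> simp [hxj] <;> tauto
  rw [key, Finset.card_union_of_disjoint, Finset.card_union_of_disjoint,
    Finset.card_union_of_disjoint]
  · cases c' <;> simp
  · rw [Finset.disjoint_left]
    intro x hx hx'
    rw [Finset.mem_erase] at hx hx'
    have := Finset.mem_Icc.1 (i₂ hx.2)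
    have := Finset.mem_Icc.1 (i₃ hx'.2)
    omega
  · rw [Finset.disjoint_left]
    intro x hx hx'
    rw [Finset.mem_union, Finset.mem_erase, Finset.mem_erase] at hx'
    have := Finset.mem_Icc.1 (i₁ (Finset.mem_of_mem_erase hx))
    rcases hx' with hx' | hx'
    · have := Finset.mem_Icc.1 (i₂ hx'.2); omega
    · have := Finset.mem_Icc.1 (i₃ hx'.2); omega
  · have k₁ : j ∉ f₁ := fun h => by have := Finset.mem_Icc.1 (i₁ h); omega
    cases c' <;> simp [k₁]

lemma exists_glue_configs {E : Finset (ℤ × ℤ)} {f : Finset ℤ} (hab : a < b)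
    (h : (E, f) ∈ configs s a b a c) :
    ∃ m j c' E₁ E₂ E₃ f₁ f₂ f₃, (E₁, f₁) ∈ configs s a m a c ∧
      (E₂, f₂) ∈ configs s (m + 1) j j c' ∧ (E₃, f₃) ∈ configs s j b j c' ∧
      (s && c && c') = false ∧ E = glue a j E₁ E₂ E₃ ∧ f = f₁ ∪ f₂ ∪ f₃ := by
  classical
  rw [mem_configs] at h
  obtain ⟨t, i, A, r⟩ := h
  obtain ⟨m, j, E₁, E₂, E₃, t₁, t₂, t₃, rfl⟩ := t.exists_glue hab
  have l₁ := t₁.le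
  have l₂ := t₂.le
  have l₃ := t₃.le
  rw [admissible_glue t₁ t₂ t₃] at A
  obtain ⟨A₁, A₂, A₃, hok⟩ := A
  have hc {x y p q : ℤ} : x ∈ f ∩ Finset.Icc p q ↔ x ∈ f ∧ p ≤ x ∧ x ≤ q := by
    rw [Finset.mem_inter, Finset.mem_Icc]
  refine ⟨m, j, decide (j ∈ f), E₁, E₂, E₃, f ∩ Finset.Icc a m, f ∩ Finset.Icc (m + 1) j,
    f ∩ Finset.Icc j b, ?_, ?_, ?_, ?_, rfl, ?_⟩
  · refine mem_configs.2 ⟨t₁, Finset.inter_subset_right,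
      A₁.congr t₁ fun x h1 h2 => ?_, ?_⟩
    · simp [h1, h2]
    · simp [l₁, r]
  · refine mem_configs.2 ⟨t₂, Finset.inter_subset_right,
      A₂.congr t₂ fun x h1 h2 => ?_, ?_⟩
    · simp [h1, h2]
    · simp [l₂]
  · refine mem_configs.2 ⟨t₃, Finset.inter_subset_right,
      A₃.congr t₃ fun x h1 h2 => ?_, ?_⟩
    · simp [h1, h2]
    · simp [l₃]
  · cases s
    · rfl
    · have := hok rfl
      cases c
      · rfl
      · simpa [r] using this
  · ext x
    simp only [Finset.mem_union, Finset.mem_inter, Finset.mem_Icc]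
    constructor
    · intro hx
      have := Finset.mem_Icc.1 (i hx)
      by_cases h1 : x ≤ m
      · exact Or.inl (Or.inl ⟨hx, by omega⟩)
      by_cases h2 : x ≤ j
      · exact Or.inl (Or.inr ⟨hx, by omega⟩)
      · exact Or.inr ⟨hx, by omega⟩
    · tauto

end

/-- The recurrence given by cutting a tree with `N + 2` vertices into three trees with `k`, `l`
and `r` edges, `k + l + r = N`; the Boolean `c'` is the label of the vertex shared by the last
two. -/
theorem treeWeight_succ {K : Type*} [CommSemiring K] (u : K) (s : Bool) (a : ℤ) (N : ℕ)
    (c : Bool) :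
    treeWeight u s a (a + (N + 1 : ℕ)) a c =
      ∑ p ∈ Finset.HasAntidiagonal.antidiagonal N,
        ∑ q ∈ Finset.HasAntidiagonal.antidiagonal p.2,
        ∑ c' ∈ Finset.univ.filter fun c' => (s && c && c') = false,
          treeWeight u s a (a + p.1) a c *
            (treeWeight u s (a + p.1 + 1) (a + p.1 + 1 + q.1) (a + p.1 + 1 + q.1) c' *
              treeWeight u s (a + p.1 + 1 + q.1) (a + p.1 + 1 + q.1 + q.2)
                (a + p.1 + 1 + q.1) c') * u ^ c'.toNat := by
  simp only [treeWeight]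
  simp_rw [Finset.sum_mul_sum, Finset.mul_sum, Finset.sum_mul, Finset.sum_sigma']
  symm
  refine Finset.sum_bij (fun x _ => (glue a (a + x.1.1 + 1 + x.2.1.1) x.2.2.2.1.1
    x.2.2.2.2.1.1 x.2.2.2.2.2.1, x.2.2.2.1.2 ∪ x.2.2.2.2.1.2 ∪ x.2.2.2.2.2.2)) ?_ ?_ ?_ ?_
  · rintro ⟨⟨k, k'⟩, ⟨l, r⟩, c', ⟨E₁, f₁⟩, ⟨E₂, f₂⟩, ⟨E₃, f₃⟩⟩ h
    simp only [Finset.mem_sigma, Finset.HasAntidiagonal.mem_antidiagonal,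
      Finset.mem_filter, Finset.mem_univ, true_and] at h ⊢
    obtain ⟨hk, hl, hok, h₁, h₂, h₃⟩ := h
    have hb : a + (N + 1 : ℕ) = a + k + 1 + l + r := by omega
    rw [hb]
    exact glue_mem_configs h₁ h₂ h₃ hok
  · rintro ⟨⟨k, k'⟩, ⟨l, r⟩, c', ⟨E₁, f₁⟩, ⟨E₂, f₂⟩, ⟨E₃, f₃⟩⟩ h
      ⟨⟨p, p'⟩, ⟨q, t⟩, d', ⟨F₁, g₁⟩, ⟨F₂, g₂⟩, ⟨F₃, g₃⟩⟩ h' heq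
    simp only [Finset.mem_sigma, Finset.HasAntidiagonal.mem_antidiagonal,
      Finset.mem_filter, Finset.mem_univ, true_and] at h h' heq
    obtain ⟨hk, hl, hok, h₁, h₂, h₃⟩ := h
    obtain ⟨hp, hq, hok', h₁', h₂', h₃'⟩ := h'
    have hb : a + k + 1 + l + r = a + p + 1 + q + t := by omega
    rw [Prod.mk.injEq] at heq
    obtain ⟨hE, hf⟩ := heq
    obtain ⟨hm, hj⟩ := glue_cut_unique (mem_configs.1 h₁).1 (mem_configs.1 h₂).1
      (mem_configs.1 h₃).1 (mem_configs.1 h₁').1 (mem_configs.1 h₂').1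
      (hb ▸ (mem_configs.1 h₃').1) hE
    obtain rfl : k = p := by omega
    obtain rfl : l = q := by omega
    obtain rfl : r = t := by omega
    obtain rfl : k' = p' := by omega
    have hE₁ : E₁ = F₁ := by
      rw [← glue_filter_left (mem_configs.1 h₁).1 (mem_configs.1 h₂).1 (mem_configs.1 h₃).1, hE,
        glue_filter_left (mem_configs.1 h₁').1 (mem_configs.1 h₂').1 (mem_configs.1 h₃').1]
    have hE₂ : E₂ = F₂ := by
      rw [← glue_filter_middle (mem_configs.1 h₁).1 (mem_configs.1 h₂).1 (mem_configs.1 h₃).1, hE,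
        glue_filter_middle (mem_configs.1 h₁').1 (mem_configs.1 h₂').1 (mem_configs.1 h₃').1]
    have hE₃ : E₃ = F₃ := by
      rw [← glue_filter_right (mem_configs.1 h₁).1 (mem_configs.1 h₂).1 (mem_configs.1 h₃).1, hE,
        glue_filter_right (mem_configs.1 h₁').1 (mem_configs.1 h₂').1 (mem_configs.1 h₃').1]
    have hf₁ : f₁ = g₁ := by
      ext x
      by_cases hx : x ≤ a + k
      · rw [← mem_union_iff_of_left h₂ h₃ hx, hf, mem_union_iff_of_left h₂' h₃' hx]
      · exact iff_of_false
          (fun h => hx (Finset.mem_Icc.1 ((mem_configs.1 h₁).2.1 h)).2)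
          (fun h => hx (Finset.mem_Icc.1 ((mem_configs.1 h₁').2.1 h)).2)
    have hf₂ : f₂ = g₂ := by
      ext x
      by_cases hx : a + k < x ∧ x ≤ a + k + 1 + l
      · rw [← mem_union_iff_of_middle h₁ h₂ h₃ hx.1 hx.2, hf,
          mem_union_iff_of_middle h₁' h₂' h₃' hx.1 hx.2]
      · exact iff_of_false
          (fun h => hx (Finset.mem_Icc.1 ((mem_configs.1 h₂).2.1 h)))
          (fun h => hx (Finset.mem_Icc.1 ((mem_configs.1 h₂').2.1 h)))
    have hf₃ : f₃ = g₃ := by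
      ext x
      by_cases hx : a + k + 1 + l ≤ x
      · rw [← mem_union_iff_of_right h₁ h₂ h₃ hx, hf, mem_union_iff_of_right h₁' h₂' h₃' hx]
      · exact iff_of_false
          (fun h => hx (Finset.mem_Icc.1 ((mem_configs.1 h₃).2.1 h)).1)
          (fun h => hx (Finset.mem_Icc.1 ((mem_configs.1 h₃').2.1 h)).1)
    subst hE₁ hE₂ hE₃ hf₁ hf₂ hf₃
    obtain rfl : c' = d' := by
      have := (mem_configs.1 h₂).2.2.2.symm.trans (mem_configs.1 h₂').2.2.2
      cases c' <;> cases d' <;> simp_all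
    rfl
  · rintro ⟨E, f⟩ h
    obtain ⟨m, j, c', E₁, E₂, E₃, f₁, f₂, f₃, h₁, h₂, h₃, hok, rfl, rfl⟩ :=
      exists_glue_configs (by omega) h
    have l₁ := (mem_configs.1 h₁).1.le
    have l₂ := (mem_configs.1 h₂).1.le
    have l₃ := (mem_configs.1 h₃).1.le
    obtain ⟨k, hk⟩ := Int.eq_ofNat_of_zero_le (sub_nonneg.2 l₁)
    obtain ⟨l, hl⟩ := Int.eq_ofNat_of_zero_le (sub_nonneg.2 l₂)
    obtain ⟨r, hr⟩ := Int.eq_ofNat_of_zero_le (sub_nonneg.2 l₃)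
    obtain rfl : m = a + k := by omega
    obtain rfl : j = a + k + 1 + l := by omega
    obtain rfl : N = k + (l + r) := by omega
    refine ⟨⟨⟨k, l + r⟩, ⟨l, r⟩, c', ⟨E₁, f₁⟩, ⟨E₂, f₂⟩, ⟨E₃, f₃⟩⟩, ?_, rfl⟩
    simp only [Finset.mem_sigma, Finset.HasAntidiagonal.mem_antidiagonal,
      Finset.mem_filter, Finset.mem_univ, true_and]
    have hb : a + k + 1 + l + r = a + (k + (l + r) + 1 : ℕ) := by omega
    exact ⟨hok, h₁, h₂, hb ▸ h₃⟩
  · rintro ⟨⟨k, k'⟩, ⟨l, r⟩, c', ⟨E₁, f₁⟩, ⟨E₂, f₂⟩, ⟨E₃, f₃⟩⟩ h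
    simp only [Finset.mem_sigma, Finset.HasAntidiagonal.mem_antidiagonal,
      Finset.mem_filter, Finset.mem_univ, true_and] at h ⊢
    obtain ⟨hk, hl, hok, h₁, h₂, h₃⟩ := h
    rw [card_erase_glue h₁ h₂ h₃, pow_add, pow_add, pow_add]

theorem treeWeight_zero {K : Type*} [CommSemiring K] (u : K) (s : Bool) (a : ℤ) (c : Bool) :
    treeWeight u s a a a c = 1 := by
  have : configs s a a a c = {(∅, if c = true then {a} else ∅)} := by
    ext ⟨E, f⟩
    rw [mem_configs, Finset.mem_singleton, Prod.mk.injEq, Finset.Icc_self]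
    constructor
    · rintro ⟨h, hf, -, hc⟩
      refine ⟨Finset.eq_empty_of_forall_notMem fun ⟨p, q⟩ hpq => ?_, ?_⟩
      · have := h.bounds _ _ hpq; omega
      · rcases Finset.subset_singleton_iff.1 hf with rfl | rfl
        · simp_all
        · simp_all
    · rintro ⟨rfl, rfl⟩
      refine ⟨⟨le_rfl, by simp, by simp, fun x h1 h2 => ?_, by simp⟩, ?_, by simp [Admissible], ?_⟩
      · rw [le_antisymm h2 h1]; exact Conn.refl _ _
      · split_ifs <;> simp
      · split_ifs <;> simp_all
  rw [treeWeight, this, Finset.sum_singleton]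
  split_ifs <;> simp

/-! ### Reflection -/

section Reflection

open scoped Pointwise

/-- The reflection of an edge set under `x ↦ -x`. -/
def reflectEdges (E : Finset (ℤ × ℤ)) : Finset (ℤ × ℤ) := E.image fun e => (-e.2, -e.1)

lemma mem_reflectEdges {E : Finset (ℤ × ℤ)} {p q : ℤ} :
    (p, q) ∈ reflectEdges E ↔ (-q, -p) ∈ E := by
  simp only [reflectEdges, Finset.mem_image, Prod.mk.injEq, Prod.exists]
  constructor
  · rintro ⟨x, y, h, rfl, rfl⟩; simpa using h
  · intro h; exact ⟨_, _, h, by simp, by simp⟩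

lemma reflectEdges_reflectEdges (E : Finset (ℤ × ℤ)) : reflectEdges (reflectEdges E) = E := by
  ext ⟨p, q⟩; simp [mem_reflectEdges]

lemma Conn.reflect {E : Finset (ℤ × ℤ)} {x y : ℤ} (h : Conn E x y) :
    Conn (reflectEdges E) (-x) (-y) := by
  induction h with
  | refl => exact Conn.refl _ _
  | tail _ hl ih =>
    refine ih.trans ?_
    rcases hl with hl | hl
    · exact (Conn.of_mem (mem_reflectEdges.2 (by simpa using hl))).symm
    · exact Conn.of_mem (mem_reflectEdges.2 (by simpa using hl))

lemma reflectEdges_erase (E : Finset (ℤ × ℤ)) (p q : ℤ) :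
    (reflectEdges E).erase (p, q) = reflectEdges (E.erase (-q, -p)) := by
  ext ⟨x, y⟩
  simp only [Finset.mem_erase, mem_reflectEdges, Ne, Prod.mk.injEq, neg_inj]
  tauto

lemma IsNCTree.reflect {a b : ℤ} {E : Finset (ℤ × ℤ)} (h : IsNCTree a b E) :
    IsNCTree (-b) (-a) (reflectEdges E) where
  le := neg_le_neg h.le
  bounds p q hpq := by
    have := h.bounds _ _ (mem_reflectEdges.1 hpq); omega
  cross p q r s hpq hrs h1 h2 h3 :=
    h.cross _ _ _ _ (mem_reflectEdges.1 hrs) (mem_reflectEdges.1 hpq) (by omega) (by omega)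
      (by omega)
  conn x hx hx' := by
    simpa using (h.conn' (x := b) (y := -x) h.le le_rfl (by omega) (by omega)).reflect
  bridge p q hpq hc := by
    rw [reflectEdges_erase] at hc
    have := hc.reflect
    rw [reflectEdges_reflectEdges] at this
    exact h.bridge _ _ (mem_reflectEdges.1 hpq) this.symm

lemma Admissible.reflect {s : Bool} {r : ℤ} {E : Finset (ℤ × ℤ)} {f : Finset ℤ}
    (h : Admissible s r E f) : Admissible (!s) (-r) (reflectEdges E) (-f) := by
  intro p q hpq hc
  rw [reflectEdges_erase] at hc
  have hc' := hc.reflect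
  rw [reflectEdges_reflectEdges, neg_neg] at hc'
  have := h (-q) (-p) (mem_reflectEdges.1 hpq) (by cases s <;> simpa using hc')
  rw [Finset.mem_neg', Finset.mem_neg']
  tauto

lemma reflect_mem_configs {s : Bool} {a b r : ℤ} {c : Bool} {E : Finset (ℤ × ℤ)} {f : Finset ℤ}
    (h : (E, f) ∈ configs s a b r c) :
    (reflectEdges E, -f) ∈ configs (!s) (-b) (-a) (-r) c := by
  rw [mem_configs] at h ⊢
  refine ⟨h.1.reflect, fun x hx => ?_, h.2.2.1.reflect, ?_⟩
  · have := Finset.mem_Icc.1 (h.2.1 (Finset.mem_neg'.1 hx))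
    exact Finset.mem_Icc.2 (by omega)
  · rw [Finset.mem_neg', neg_neg]; exact h.2.2.2

theorem treeWeight_reflect {K : Type*} [CommSemiring K] (u : K) (s : Bool) (a b r : ℤ)
    (c : Bool) : treeWeight u s a b r c = treeWeight u (!s) (-b) (-a) (-r) c := by
  refine Finset.sum_bij' (fun P _ => (reflectEdges P.1, -P.2))
    (fun P _ => (reflectEdges P.1, -P.2)) (fun P h => reflect_mem_configs h) (fun P h => ?_)
    (fun P _ => by simp [reflectEdges_reflectEdges])
    (fun P _ => by simp [reflectEdges_reflectEdges]) (fun P _ => ?_)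
  · simpa using reflect_mem_configs h
  · congr 1
    have : (-P.2).erase (-r) = -(P.2.erase r) := by
      ext x
      simp only [Finset.mem_erase, Finset.mem_neg']
      rw [Ne, Ne, neg_eq_iff_eq_neg]
    rw [this, Finset.card_neg]

end Reflection

/-! ### Lagrange inversion -/

section Lagrange

open Polynomial

variable {K : Type*} [CommRing K]

/-- The equation `z = X ψ(z)` has a solution in power series: the coefficients of the iterates
of `z ↦ X ψ(z)` stabilise. -/
theorem exists_eq_X_mul_aeval (ψ : K[X]) :
    ∃ z : PowerSeries K, z = PowerSeries.X * aeval z ψ := by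
  have hdvd (x y : PowerSeries K) : x - y ∣ aeval x ψ - aeval y ψ := by
    simpa [aeval_def, eval₂_eq_eval_map] using
      (ψ.map (algebraMap K (PowerSeries K))).sub_dvd_eval_sub x y
  let F : PowerSeries K → PowerSeries K := fun x => PowerSeries.X * aeval x ψ
  have hF {n : ℕ} {x y : PowerSeries K} (h : PowerSeries.X ^ n ∣ x - y) :
      PowerSeries.X ^ (n + 1) ∣ F x - F y := by
    simp only [F, ← mul_sub, pow_succ']
    exact mul_dvd_mul_left _ (h.trans (hdvd x y))
  have hstep (n : ℕ) : PowerSeries.X ^ n ∣ F^[n + 1] 0 - F^[n] 0 := by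
    induction n with
    | zero => simp
    | succ n ih =>
      have := hF ih
      rwa [← Function.iterate_succ_apply' F, ← Function.iterate_succ_apply' F] at this
  have hstab (n k : ℕ) : PowerSeries.X ^ n ∣ F^[n + k] 0 - F^[n] 0 := by
    induction k with
    | zero => simp
    | succ k ih =>
      have := (pow_dvd_pow PowerSeries.X (Nat.le_add_right n k)).trans (hstep (n + k))
      simpa [← add_assoc] using dvd_add this ih
  let z : PowerSeries K := PowerSeries.mk fun n => PowerSeries.coeff n (F^[n + 1] 0)
  have hz (n : ℕ) : PowerSeries.X ^ n ∣ z - F^[n] 0 := by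
    rw [PowerSeries.X_pow_dvd_iff]
    intro m hm
    obtain ⟨k, rfl⟩ := Nat.exists_eq_add_of_lt hm
    have := PowerSeries.X_pow_dvd_iff.1 (hstab (m + 1) k) m (Nat.lt_succ_self m)
    rw [map_sub, sub_eq_zero] at this ⊢
    rw [show m + k + 1 = m + 1 + k by omega, this]
    simp [z]
  refine ⟨z, ?_⟩
  ext n
  have h1 := PowerSeries.X_pow_dvd_iff.1 (hz (n + 2)) n (by omega)
  have h2 := PowerSeries.X_pow_dvd_iff.1 (hF (hz (n + 1))) n (by omega)
  rw [map_sub, sub_eq_zero] at h1 h2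
  rw [h1, Function.iterate_succ_apply', ← h2]

/-- Lagrange inversion. Writing `h = h(0) + X h₁` turns the coefficient of index `N + 1` of `h(z)`
into the coefficient of index `N` of `(ψ h₁)(z)`, and the claimed formula obeys the same
recursion. -/
theorem lagrange_inversion [IsDomain K] [CharZero K] {ψ : K[X]} {z : PowerSeries K}
    (hz : z = PowerSeries.X * aeval z ψ) (N : ℕ) (h : K[X]) :
    ((N : K) + 1) * PowerSeries.coeff (N + 1) (aeval z h) =
      (derivative h * ψ ^ (N + 1)).coeff N := by
  have hz0 : PowerSeries.constantCoeff z = 0 := by rw [hz]; simp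
  have hshift (N : ℕ) (g : K[X]) (c : K) : PowerSeries.coeff (N + 1) (aeval z (g * X + C c)) =
      PowerSeries.coeff N (aeval z (ψ * g)) := by
    have : aeval z (g * X + C c) = PowerSeries.X * aeval z (ψ * g) + PowerSeries.C c := by
      rw [map_add, map_mul, map_mul, aeval_X, aeval_C]
      conv_lhs => rw [hz, ← hz]
      rw [PowerSeries.algebraMap_apply]
      simp only [Algebra.algebraMap_self, RingHom.id_apply]
      linear_combination (aeval z g) * hz
    rw [this, map_add, PowerSeries.coeff_succ_X_mul, PowerSeries.coeff_C, if_neg (by omega),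
      add_zero]
  induction N generalizing h with
  | zero =>
    rw [← divX_mul_X_add h, hshift]
    have : PowerSeries.constantCoeff (aeval z (ψ * h.divX)) = (ψ * h.divX).coeff 0 := by
      rw [aeval_def, hom_eval₂, hz0]
      rw [eval₂_at_zero]
      simp
    rw [PowerSeries.coeff_zero_eq_constantCoeff_apply, this]
    simp [mul_coeff_zero, coeff_derivative, mul_comm]
  | succ M ih =>
    rw [← divX_mul_X_add h, hshift]
    set g := h.divX
    have h1 := ih (ψ * g)
    have h2 := coeff_derivative (g * ψ ^ (M + 2)) M
    have hM : (M : K) + 1 ≠ 0 := by exact_mod_cast Nat.succ_ne_zero M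
    -- multiplied by `M + 1`, both sides are compared through the derivative of `g ψ ^ (M + 2)`
    apply mul_left_cancel₀ hM
    have e1 : derivative (g * X + C (h.coeff 0)) * ψ ^ (M + 2) =
        g * ψ ^ (M + 2) + derivative g * ψ ^ (M + 2) * X := by
      simp only [derivative_add, derivative_mul, derivative_X, derivative_C]
      ring
    have e2 : derivative (g * ψ ^ (M + 2)) =
        C ((M : K) + 2) * (derivative (ψ * g) * ψ ^ (M + 1)) -
          C ((M : K) + 1) * (derivative g * ψ ^ (M + 2)) := by
      simp only [derivative_mul, derivative_pow, map_add, map_natCast, map_one, map_ofNat]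
      push_cast
      ring
    rw [e2, coeff_sub, coeff_C_mul, coeff_C_mul, ← h1] at h2
    rw [e1, coeff_add, coeff_mul_X]
    push_cast
    linear_combination h2

end Lagrange

/-! ### The generating functions -/

section GeneratingFunction

variable {K : Type*} [CommRing K]

/-- The weights of the trees with a given type of root, in terms of the solution `z` of
`z = X (1 + z) ^ 3 (1 + u z) ^ 2`, are the coefficients of `1 + z` if the label condition
concerns all edges at the root and the root carries the large label, and of `(1 + z) (1 + u z)`
otherwise. -/
noncomputable def treeSeries (u : K) (z : PowerSeries K) (s c : Bool) : PowerSeries K :=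
  if s && c then 1 + z else (1 + z) * (1 + PowerSeries.C u * z)

lemma treeSeries_eq {u : K} {z : PowerSeries K}
    (hz : z = PowerSeries.X * ((1 + z) ^ 3 * (1 + PowerSeries.C u * z) ^ 2)) (s c : Bool) :
    treeSeries u z s c = 1 + PowerSeries.X * ∑ c' ∈ Finset.univ.filter
      fun c' => (s && c && c') = false, treeSeries u z s c *
        (treeSeries u z (!s) c' * treeSeries u z s c') * PowerSeries.C (u ^ c'.toNat) := by
  cases s <;> cases c <;> simp [Finset.sum_filter, treeSeries]
  · linear_combination (1 + PowerSeries.C u + PowerSeries.C u * z) * hz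
  · linear_combination (1 + PowerSeries.C u + PowerSeries.C u * z) * hz
  · linear_combination (1 + PowerSeries.C u + PowerSeries.C u * z) * hz
  · linear_combination hz

theorem treeWeight_eq_coeff {u : K} {z : PowerSeries K}
    (hz : z = PowerSeries.X * ((1 + z) ^ 3 * (1 + PowerSeries.C u * z) ^ 2)) (N : ℕ) (a : ℤ)
    (s c : Bool) :
    treeWeight u s a (a + N) a c = PowerSeries.coeff N (treeSeries u z s c) := by
  have hz0 : PowerSeries.constantCoeff z = 0 := by rw [hz]; simp
  induction N using Nat.strong_induction_on generalizing a s c with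
  | _ N ih =>
  cases N with
  | zero =>
    rw [Nat.cast_zero, add_zero, treeWeight_zero, PowerSeries.coeff_zero_eq_constantCoeff_apply,
      treeSeries]
    split_ifs <;> simp [hz0]
  | succ N =>
    rw [treeWeight_succ, treeSeries_eq hz, map_add, PowerSeries.coeff_succ_X_mul,
      PowerSeries.coeff_one, if_neg (by omega), zero_add, map_sum]
    simp_rw [PowerSeries.coeff_mul_C, PowerSeries.coeff_mul, Finset.mul_sum, Finset.sum_mul]
    conv_rhs => rw [Finset.sum_comm]
    refine Finset.sum_congr rfl fun p hp => ?_
    conv_rhs => rw [Finset.sum_comm]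
    refine Finset.sum_congr rfl fun q hq => Finset.sum_congr rfl fun c' _ => ?_
    rw [Finset.HasAntidiagonal.mem_antidiagonal] at hp hq
    -- the middle part has its root at the right end, so it is reflected first
    rw [ih p.1 (by omega), ih q.2 (by omega), treeWeight_reflect,
      show -(a + p.1 + 1) = -(a + p.1 + 1 + q.1) + (q.1 : ℤ) by ring, ih q.1 (by omega)]

/-- The total weight of the trees with `N + 1` vertices, rooted at the first one. -/
theorem treeWeight_add_mul_treeWeight {u : K} {z : PowerSeries K}
    (hz : z = PowerSeries.X * ((1 + z) ^ 3 * (1 + PowerSeries.C u * z) ^ 2)) (N : ℕ) (a : ℤ) :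
    treeWeight u true a (a + N) a false + u * treeWeight u true a (a + N) a true =
      PowerSeries.coeff N ((1 + z) * (1 + PowerSeries.C u + PowerSeries.C u * z)) := by
  rw [treeWeight_eq_coeff hz, treeWeight_eq_coeff hz, ← PowerSeries.coeff_C_mul, ← map_add]
  congr 1
  simp only [treeSeries, Bool.and_false, Bool.and_true, if_true, Bool.false_eq_true, if_false]
  ring

end GeneratingFunction

section Coefficients

open Polynomial

/-- Lagrange inversion applied to `h = (1 + X) (1 + u + u X)` and `ψ = (1 + X) ^ 3 (1 + u X) ^ 2`
counts the trees with `N + 2` vertices by the number of large labels. -/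
theorem treeWeight_eq_coeff_polynomial {K : Type*} [CommRing K] [IsDomain K] [CharZero K] (u : K)
    (N : ℕ) (a : ℤ) :
    ((N : K) + 1) * (treeWeight u true a (a + (N + 1 : ℕ)) a false +
        u * treeWeight u true a (a + (N + 1 : ℕ)) a true) =
      ((1 + 2 * C u + 2 * C u * X) *
        ((1 + X) ^ 3 * (1 + C u * X) ^ 2) ^ (N + 1) : K[X]).coeff N := by
  obtain ⟨z, hz⟩ := exists_eq_X_mul_aeval ((1 + X) ^ 3 * (1 + C u * X) ^ 2 : K[X])
  have hz' : z = PowerSeries.X * ((1 + z) ^ 3 * (1 + PowerSeries.C u * z) ^ 2) := by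
    simpa [PowerSeries.algebraMap_apply] using hz
  have h := lagrange_inversion hz N ((1 + X) * (1 + C u + C u * X))
  rw [treeWeight_add_mul_treeWeight hz']
  have e1 : aeval z ((1 + X) * (1 + C u + C u * X) : K[X]) =
      (1 + z) * (1 + PowerSeries.C u + PowerSeries.C u * z) := by
    simp
  have e2 : derivative ((1 + X) * (1 + C u + C u * X) : K[X]) = 1 + 2 * C u + 2 * C u * X := by
    simp
    ring
  rw [← e1, h, e2]

end Coefficients

/-! ### From graphs to edge sets -/

namespace KNoncrossingTree

variable {n : ℕ}

open Classical in
/-- The edges of a graph on `v₁, …, vₙ` as pairs of integers in increasing order, the vertex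
`v_{i+1}` becoming the integer `i`. -/
noncomputable def edgePairs (G : SimpleGraph (Fin n)) : Finset (ℤ × ℤ) :=
  (Finset.univ.filter fun e : Fin n × Fin n => e.1 < e.2 ∧ G.Adj e.1 e.2).image
    fun e => ((e.1 : ℤ), (e.2 : ℤ))

lemma mem_edgePairs {G : SimpleGraph (Fin n)} {p q : ℤ} :
    (p, q) ∈ edgePairs G ↔ ∃ i j : Fin n, i < j ∧ G.Adj i j ∧ (i : ℤ) = p ∧ (j : ℤ) = q := by
  simp only [edgePairs, Finset.mem_image, Finset.mem_filter, Finset.mem_univ, true_and,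
    Prod.exists, Prod.mk.injEq, and_assoc]

lemma coe_inj {i j : Fin n} : ((i : ℕ) : ℤ) = ((j : ℕ) : ℤ) ↔ i = j := by
  rw [Nat.cast_inj, Fin.val_inj]

lemma coe_mem_edgePairs {G : SimpleGraph (Fin n)} {i j : Fin n} :
    ((i : ℤ), (j : ℤ)) ∈ edgePairs G ↔ i < j ∧ G.Adj i j := by
  rw [mem_edgePairs]
  constructor
  · rintro ⟨i', j', h1, h2, h3, h4⟩
    rw [coe_inj] at h3 h4
    subst h3 h4
    exact ⟨h1, h2⟩
  · rintro ⟨h1, h2⟩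
    exact ⟨i, j, h1, h2, rfl, rfl⟩

lemma linked_edgePairs {G : SimpleGraph (Fin n)} {i j : Fin n} :
    Linked (edgePairs G) i j ↔ G.Adj i j := by
  rw [Linked, coe_mem_edgePairs, coe_mem_edgePairs, G.adj_comm j i]
  constructor
  · tauto
  · intro h
    rcases lt_or_gt_of_ne h.ne with h' | h'
    · exact Or.inl ⟨h', h⟩
    · exact Or.inr ⟨h', h⟩

lemma edgePairs_injective : Function.Injective (edgePairs (n := n)) := by
  intro G H h
  ext i j
  rw [← linked_edgePairs, h, linked_edgePairs]

lemma conn_edgePairs {G : SimpleGraph (Fin n)} {i j : Fin n} :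
    Conn (edgePairs G) i j ↔ G.Reachable i j := by
  rw [SimpleGraph.reachable_iff_reflTransGen]
  constructor
  · intro h
    have key (x : ℤ) (h : Conn (edgePairs G) i x) :
        ∃ k : Fin n, (k : ℤ) = x ∧ Relation.ReflTransGen G.Adj i k := by
      induction h with
      | refl => exact ⟨i, rfl, .refl⟩
      | @tail _ y _ hl ih =>
        obtain ⟨k, rfl, hk⟩ := ih
        have : ∃ l : Fin n, (l : ℤ) = y := by
          rcases hl with hl | hl
          · obtain ⟨_, l, -, -, -, h⟩ := mem_edgePairs.1 hl; exact ⟨l, h⟩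
          · obtain ⟨l, _, -, -, h, -⟩ := mem_edgePairs.1 hl; exact ⟨l, h⟩
        obtain ⟨l, rfl⟩ := this
        exact ⟨l, rfl, hk.tail (linked_edgePairs.1 hl)⟩
    obtain ⟨k, hk, h⟩ := key _ h
    rw [coe_inj] at hk
    exact hk ▸ h
  · intro h
    exact h.lift (fun k : Fin n => (k : ℤ)) fun _ _ h => linked_edgePairs.2 h

lemma edgePairs_deleteEdges (G : SimpleGraph (Fin n)) {i j : Fin n} (hij : i < j) :
    edgePairs (G.deleteEdges {s(i, j)}) = (edgePairs G).erase ((i : ℤ), (j : ℤ)) := by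
  ext ⟨p, q⟩
  simp only [Finset.mem_erase, mem_edgePairs, SimpleGraph.deleteEdges_adj, Set.mem_singleton_iff]
  constructor
  · rintro ⟨k, l, hkl, ⟨h, hne⟩, rfl, rfl⟩
    refine ⟨fun h => hne ?_, k, l, hkl, h, rfl, rfl⟩
    rw [Prod.mk.injEq, coe_inj, coe_inj] at h
    rw [h.1, h.2]
  · rintro ⟨hne, k, l, hkl, h, rfl, rfl⟩
    refine ⟨k, l, hkl, ⟨h, fun h => hne ?_⟩, rfl, rfl⟩
    rw [Sym2.eq_iff] at h
    rcases h with ⟨rfl, rfl⟩ | ⟨rfl, rfl⟩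
    · rfl
    · exact absurd hkl hij.asymm

/-- In an acyclic graph, the endpoint `i` of an edge `{i, j}` lies on a path from `r` to `j` if and
only if it is connected to `r` after deletion of that edge. -/
lemma exists_path_iff {V : Type*} {G : SimpleGraph V} {r i j : V} (h : G.Adj i j)
    (hG : G.IsAcyclic) :
    (∃ p : G.Walk r j, p.IsPath ∧ i ∈ p.support) ↔ (G.deleteEdges {s(i, j)}).Reachable r i := by
  classical
  constructor
  · rintro ⟨p, hp, hi⟩
    have hj := SimpleGraph.Walk.endpoint_notMem_support_takeUntil hp hi h.ne.symm
    rw [SimpleGraph.reachable_deleteEdges_iff_exists_walk]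
    exact ⟨p.takeUntil i hi, fun hmem => hj (SimpleGraph.Walk.snd_mem_support_of_mem_edges _ hmem)⟩
  · intro hr
    obtain ⟨q, hq⟩ := hr.exists_isPath
    have hj : j ∉ q.support := fun hj =>
      SimpleGraph.isAcyclic_iff_forall_adj_isBridge.1 hG h ⟨(q.dropUntil j hj).reverse⟩
    have hle : G.deleteEdges {s(i, j)} ≤ G := SimpleGraph.deleteEdges_le _
    refine ⟨(q.mapLe hle).concat h, (hq.mapLe hle).concat (by simpa using hj) h, ?_⟩
    rw [SimpleGraph.Walk.support_concat]
    simp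

/-- The noncrossing trees on `v₁, …, v_{N+1}` correspond to those on the integers `0, …, N`. -/
lemma isNCTree_edgePairs {N : ℕ} {G : SimpleGraph (Fin (N + 1))} :
    IsNCTree 0 N (edgePairs G) ↔ G.IsTree ∧ IsNoncrossing G := by
  constructor
  · intro h
    refine ⟨⟨⟨fun i j => ?_⟩,
      SimpleGraph.isAcyclic_iff_forall_adj_isBridge.2 fun i j hij => ?_⟩, ?_⟩
    · exact conn_edgePairs.1 (h.conn' (by omega) (by omega) (by omega) (by omega))
    · rcases lt_or_gt_of_ne hij.ne with hlt | hlt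
      · rw [SimpleGraph.isBridge_iff, ← conn_edgePairs, edgePairs_deleteEdges G hlt]
        exact h.bridge _ _ (coe_mem_edgePairs.2 ⟨hlt, hij⟩)
      · rw [Sym2.eq_swap, SimpleGraph.isBridge_iff, ← conn_edgePairs, edgePairs_deleteEdges G hlt]
        exact h.bridge _ _ (coe_mem_edgePairs.2 ⟨hlt, hij.symm⟩)
    · rintro a b c d hab hbc hcd ⟨hac, hbd⟩
      exact h.cross _ _ _ _ (coe_mem_edgePairs.2 ⟨hab.trans hbc, hac⟩)
        (coe_mem_edgePairs.2 ⟨hbc.trans hcd, hbd⟩) (by exact_mod_cast hab) (by exact_mod_cast hbc)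
        (by exact_mod_cast hcd)
  · rintro ⟨hT, hN⟩
    refine ⟨by omega, ?_, ?_, ?_, ?_⟩
    · intro p q h
      obtain ⟨i, j, hij, -, rfl, rfl⟩ := mem_edgePairs.1 h
      have : (i : ℕ) < j := hij
      omega
    · intro p q r s h h' h1 h2 h3
      obtain ⟨i, j, -, hij, rfl, rfl⟩ := mem_edgePairs.1 h
      obtain ⟨k, l, -, hkl, rfl, rfl⟩ := mem_edgePairs.1 h'
      exact hN i k j l (by exact_mod_cast h1) (by exact_mod_cast h2) (by exact_mod_cast h3)
        ⟨hij, hkl⟩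
    · intro x hx hx'
      obtain ⟨k, rfl⟩ := Int.eq_ofNat_of_zero_le hx
      exact conn_edgePairs (i := 0) (j := ⟨k, by omega⟩) |>.2 (hT.1.preconnected _ _)
    · intro p q h
      obtain ⟨i, j, hij, hadj, rfl, rfl⟩ := mem_edgePairs.1 h
      rw [← edgePairs_deleteEdges G hij, conn_edgePairs]
      exact SimpleGraph.isAcyclic_iff_forall_adj_isBridge.1 hT.2 hadj

lemma exists_edgePairs_eq {N : ℕ} {E : Finset (ℤ × ℤ)} (hE : IsNCTree 0 N E) :
    ∃ G : SimpleGraph (Fin (N + 1)), edgePairs G = E := by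
  refine ⟨⟨fun i j => Linked E i j, ⟨fun _ _ h => h.symm⟩, ⟨fun i h => ?_⟩⟩, ?_⟩
  · rcases h with h | h <;> have := hE.bounds _ _ h <;> omega
  · ext ⟨p, q⟩
    rw [mem_edgePairs]
    constructor
    · rintro ⟨i, j, hij, h | h, rfl, rfl⟩
      · exact h
      · have := hE.bounds _ _ h
        have : (i : ℕ) < j := hij
        omega
    · intro h
      have hb := hE.bounds _ _ h
      obtain ⟨k, rfl⟩ := Int.eq_ofNat_of_zero_le hb.1
      obtain ⟨l, rfl⟩ := Int.eq_ofNat_of_zero_le (hb.1.trans hb.2.1.le)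
      exact ⟨⟨k, by omega⟩, ⟨l, by omega⟩, by simp only [Fin.mk_lt_mk]; omega, Or.inl h, rfl, rfl⟩

open Classical in
/-- The vertices with label `2`, as integers. -/
noncomputable def bigVertices {k : ℕ} (l : Fin n → Finset.Icc 1 k) : Finset ℤ :=
  (Finset.univ.filter fun v : Fin n => (l v : ℕ) = 2).image fun v : Fin n => (v : ℤ)

lemma coe_mem_bigVertices {k : ℕ} {l : Fin n → Finset.Icc 1 k} {v : Fin n} :
    (v : ℤ) ∈ bigVertices l ↔ (l v : ℕ) = 2 := by
  simp only [bigVertices, Finset.mem_image, Finset.mem_filter, Finset.mem_univ, true_and, coe_inj,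
    exists_eq_right]

lemma card_bigVertices {k : ℕ} (l : Fin n → Finset.Icc 1 k) :
    (bigVertices l).card = (Finset.univ.filter fun v : Fin n => (l v : ℕ) = 2).card := by
  rw [bigVertices, Finset.card_image_of_injective _ fun _ _ h => coe_inj.1 h]

lemma bigVertices_injective {l l' : Fin n → Finset.Icc 1 2} (h : bigVertices l = bigVertices l') :
    l = l' := by
  funext v
  have h1 := coe_mem_bigVertices (l := l) (v := v)
  rw [h, coe_mem_bigVertices] at h1
  have h2 := Finset.mem_Icc.1 (l v).2
  have h3 := Finset.mem_Icc.1 (l' v).2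
  exact Subtype.ext (by omega)

lemma exists_bigVertices_eq {N : ℕ} {f : Finset ℤ} (hf : f ⊆ Finset.Icc 0 (N : ℤ)) :
    ∃ l : Fin (N + 1) → Finset.Icc 1 2, bigVertices l = f := by
  refine ⟨fun v => if (v : ℤ) ∈ f then ⟨2, by simp⟩ else ⟨1, by simp⟩, ?_⟩
  ext x
  constructor
  · intro hx
    have hx' := hx
    simp only [bigVertices, Finset.mem_image] at hx'
    obtain ⟨v, -, rfl⟩ := hx'
    rw [coe_mem_bigVertices] at hx
    by_contra hv
    simp [hv] at hx
  · intro hx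
    have hb := Finset.mem_Icc.1 (hf hx)
    obtain ⟨k, rfl⟩ := Int.eq_ofNat_of_zero_le hb.1
    have := coe_mem_bigVertices (v := (⟨k, by omega⟩ : Fin (N + 1)))
      (l := fun v : Fin (N + 1) => if (v : ℤ) ∈ f then (⟨2, by simp⟩ : Finset.Icc 1 2)
        else ⟨1, by simp⟩)
    exact this.2 (by simp [hx])

/-- For labels in `{1, 2}`, the label condition of a `2`-noncrossing tree is the condition that no
edge directed upwards joins two vertices with label `2`. -/
lemma admissible_edgePairs {N : ℕ} {G : SimpleGraph (Fin (N + 1))} (hG : G.IsTree)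
    {l : Fin (N + 1) → Finset.Icc 1 2} :
    Admissible true 0 (edgePairs G) (bigVertices l) ↔
      ∀ root i j : Fin (N + 1), (root : ℕ) = 0 → i < j → G.Adj i j →
        (∃ p : G.Walk root j, p.IsPath ∧ i ∈ p.support) → (l i : ℕ) + (l j : ℕ) ≤ 2 + 1 := by
  have key (i j : Fin (N + 1)) (hij : i < j) : Conn ((edgePairs G).erase ((i : ℤ), (j : ℤ))) 0 i ↔
      (G.deleteEdges {s(i, j)}).Reachable 0 i := by
    rw [← edgePairs_deleteEdges G hij, ← conn_edgePairs]
    simp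
  constructor
  · intro h root i j hroot hij hadj hp
    obtain rfl : root = 0 := Fin.ext hroot
    rw [exists_path_iff hadj hG.2, ← key i j hij] at hp
    have := h i j (coe_mem_edgePairs.2 ⟨hij, hadj⟩) hp
    rw [coe_mem_bigVertices, coe_mem_bigVertices] at this
    have h2 := Finset.mem_Icc.1 (l i).2
    have h3 := Finset.mem_Icc.1 (l j).2
    omega
  · intro h p q hpq hc
    obtain ⟨i, j, hij, hadj, rfl, rfl⟩ := mem_edgePairs.1 hpq
    have := h 0 i j rfl hij hadj ((exists_path_iff hadj hG.2).2 ((key i j hij).1 hc))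
    rw [coe_mem_bigVertices, coe_mem_bigVertices]
    omega

lemma graph_label_injective {k : ℕ} {T T' : KNoncrossingTree k n} (h : T.graph = T'.graph)
    (h' : T.label = T'.label) : T = T' := by
  cases T; cases T'; simp_all

instance (k : ℕ) : Finite (KNoncrossingTree k n) :=
  Finite.of_injective (fun T => (T.graph, T.label)) fun _ _ h =>
    graph_label_injective (Prod.ext_iff.1 h).1 (Prod.ext_iff.1 h).2

noncomputable instance (k : ℕ) : Fintype (KNoncrossingTree k n) := Fintype.ofFinite _

/-- The generating polynomial of the `2`-noncrossing trees by the number of labels `2`. -/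
theorem sum_pow_card {K : Type*} [CommSemiring K] (u : K) (N : ℕ) :
    ∑ T : KNoncrossingTree 2 (N + 1), u ^ (Finset.univ.filter fun v => (T.label v : ℕ) = 2).card =
      treeWeight u true 0 N 0 false + u * treeWeight u true 0 N 0 true := by
  classical
  have hR : treeWeight u true 0 N 0 false + u * treeWeight u true 0 N 0 true =
      ∑ x ∈ (Finset.univ : Finset Bool).sigma fun c => configs true 0 N 0 c, u ^ x.2.2.card := by
    rw [Finset.sum_sigma, Fintype.sum_bool, add_comm, treeWeight, treeWeight, Finset.mul_sum]
    refine congrArg₂ _ (Finset.sum_congr rfl fun P hP => ?_) (Finset.sum_congr rfl fun P hP => ?_)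
    · rw [← Finset.card_erase_add_one (a := 0) (s := P.2) ((mem_configs.1 hP).2.2.2.2 rfl),
        pow_succ']
    · rw [Finset.erase_eq_of_notMem]
      simpa using (mem_configs.1 hP).2.2.2
  rw [hR]
  have hmem (T : KNoncrossingTree 2 (N + 1)) : (edgePairs T.graph, bigVertices T.label) ∈
      configs true 0 N 0 (decide ((0 : ℤ) ∈ bigVertices T.label)) := by
    refine mem_configs.2 ⟨isNCTree_edgePairs.2 ⟨T.isTree, T.noncrossing⟩, fun x hx => ?_,
      (admissible_edgePairs T.isTree).2 T.label_add_le, by simp⟩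
    simp only [bigVertices, Finset.mem_image] at hx
    obtain ⟨v, -, rfl⟩ := hx
    rw [Finset.mem_Icc]
    omega
  refine Finset.sum_bij (fun T _ => ⟨decide ((0 : ℤ) ∈ bigVertices T.label),
    (edgePairs T.graph, bigVertices T.label)⟩) ?_ ?_ ?_ ?_
  · intro T _
    exact Finset.mem_sigma.2 ⟨Finset.mem_univ _, hmem T⟩
  · intro T _ T' _ h
    simp only [Sigma.mk.injEq, heq_eq_eq, Prod.mk.injEq] at h
    exact graph_label_injective (edgePairs_injective h.2.1) (bigVertices_injective h.2.2)
  · rintro ⟨c, E, f⟩ h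
    obtain ⟨hE, hf, hA, hc⟩ := mem_configs.1 (Finset.mem_sigma.1 h).2
    obtain ⟨G, rfl⟩ := exists_edgePairs_eq hE
    obtain ⟨l, rfl⟩ := exists_bigVertices_eq hf
    obtain ⟨hG, hN⟩ := isNCTree_edgePairs.1 hE
    refine ⟨⟨G, hG, hN, l, (admissible_edgePairs hG).1 hA⟩, Finset.mem_univ _, ?_⟩
    simp [hc]
  · intro T _
    simp only [card_bigVertices]

end KNoncrossingTree

/-! ### Binomial moments -/

section Moments

open Polynomial

lemma exists_add_pow_eq {R : Type*} [CommRing R] (a b : R) (m : ℕ) :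
    ∃ q, (a + b) ^ (m + 2) = a ^ (m + 2) + (m + 2) * a ^ (m + 1) * b +
      ((m + 2).choose 2 : R) * a ^ m * b ^ 2 + b ^ 3 * q := by
  induction m with
  | zero => exact ⟨0, by simp; ring⟩
  | succ m ih =>
    obtain ⟨q, hq⟩ := ih
    refine ⟨((m + 2).choose 2 : R) * a ^ m + (a + b) * q, ?_⟩
    rw [show m + 1 + 2 = (m + 2) + 1 by ring, pow_succ, hq, Nat.choose_succ_succ' (m + 2) 1,
      Nat.choose_one_right]
    push_cast
    ring

/-- The coefficient of `v ^ i` in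
`(3 + 2 X + 2 v (1 + X)) ((1 + X) ^ 3 (1 + (1 + v) X) ^ 2) ^ (N + 1)`, as a polynomial in `X`, for
`i < 3`; the value `0` for larger `i` is a placeholder. Its coefficient of index `N` is `N + 1`
times the number of trees with `N + 2` vertices and a distinguished set of `i` vertices with
label `2`. -/
noncomputable def momentPolynomial (N : ℕ) : ℕ → ℝ[X]
  | 0 => (3 + 2 * X) * (1 + X) ^ (5 * N + 5)
  | 1 => C (2 * N + 2 : ℝ) * (3 + 2 * X) * X * (1 + X) ^ (5 * N + 4) + 2 * (1 + X) ^ (5 * N + 6)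
  | 2 => C ((2 * N + 2).choose 2 : ℝ) * (3 + 2 * X) * X ^ 2 * (1 + X) ^ (5 * N + 3) +
      2 * C (2 * N + 2 : ℝ) * X * (1 + X) ^ (5 * N + 5)
  | _ => 0

/-- The substitution `u = 1 + v` turns the generating polynomial of the number of labels `2` into
that of its binomial moments. Here `C X` plays the role of `v`. -/
lemma exists_shift_expansion (N : ℕ) : ∃ Q : ℝ[X][X],
    ((1 + 2 * C (1 + X) + 2 * C (1 + X) * X) *
        ((1 + X) ^ 3 * (1 + C (1 + X) * X) ^ 2) ^ (N + 1) : ℝ[X][X]) =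
      (momentPolynomial N 0).map C + C X * (momentPolynomial N 1).map C +
        C X ^ 2 * (momentPolynomial N 2).map C + C X ^ 3 * Q := by
  obtain ⟨q, hq⟩ := exists_add_pow_eq (1 + X : ℝ[X][X]) (C X * X) (2 * N)
  refine ⟨(1 + X) ^ (3 * N + 3) * ((3 + 2 * X) * X ^ 3 * q + 2 * (1 + X) *
    (((2 * N + 2).choose 2 : ℝ[X][X]) * (1 + X) ^ (2 * N) * X ^ 2 + C X * (X ^ 3 * q))), ?_⟩
  have e : ((1 + X) ^ 3 * (1 + C (1 + X) * X) ^ 2 : ℝ[X][X]) ^ (N + 1) =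
      (1 + X) ^ (3 * N + 3) * (1 + X + C X * X) ^ (2 * N + 2) := by
    rw [map_add, map_one, mul_pow, ← pow_mul, ← pow_mul, show 2 * (N + 1) = 2 * N + 2 by ring,
      show 3 * (N + 1) = 3 * N + 3 by ring, add_mul, one_mul, ← add_assoc]
  have e' : (1 + 2 * C (1 + X) + 2 * C (1 + X) * X : ℝ[X][X]) =
      3 + 2 * X + 2 * C X * (1 + X) := by
    rw [map_add, map_one]
    ring
  rw [e, e', hq]
  simp only [momentPolynomial, Polynomial.map_add, Polynomial.map_mul, Polynomial.map_pow,
    Polynomial.map_one, Polynomial.map_X, Polynomial.map_ofNat, Polynomial.map_natCast, map_add,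
    map_mul, map_natCast, map_ofNat]
  push_cast
  generalize (1 + X : ℝ[X][X]) = Y
  ring

lemma coeff_shift_expansion (N : ℕ) {i : ℕ} (hi : i < 3) :
    ((((1 + 2 * C (1 + X) + 2 * C (1 + X) * X) *
        ((1 + X) ^ 3 * (1 + C (1 + X) * X) ^ 2) ^ (N + 1) : ℝ[X][X]).coeff N).coeff i) =
      (momentPolynomial N i).coeff N := by
  obtain ⟨Q, hQ⟩ := exists_shift_expansion N
  rw [hQ]
  simp only [← C_pow, coeff_add, coeff_C_mul, coeff_map]
  interval_cases i <;> simp [coeff_X_pow_mul', coeff_X_pow, coeff_X, coeff_C]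

/-- The binomial moments of the number of labels `2`, over all `2`-noncrossing trees with `N + 2`
vertices. -/
theorem sum_choose_eq (N : ℕ) {i : ℕ} (hi : i < 3) :
    ((N : ℝ) + 1) * ∑ T : KNoncrossingTree 2 (N + 2),
        (((Finset.univ.filter fun v => (T.label v : ℕ) = 2).card.choose i : ℕ) : ℝ) =
      (momentPolynomial N i).coeff N := by
  have h := treeWeight_eq_coeff_polynomial (1 + X : ℝ[X]) N 0
  rw [zero_add, ← KNoncrossingTree.sum_pow_card] at h
  have h' := congrArg (fun p => coeff p i) h
  simp only [coeff_shift_expansion N hi] at h'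
  rw [← h', show ((N : ℝ[X]) + 1) = C ((N : ℝ) + 1) by simp, coeff_C_mul, finsetSum_coeff]
  simp_rw [coeff_one_add_X_pow]

lemma coeff_X_pow_succ_mul_one_add_X_pow (N m i : ℕ) :
    ((m : ℝ) + 1) * (X ^ (i + 1) * (1 + X) ^ m : ℝ[X]).coeff N =
      ((N : ℝ) - i) * (X ^ i * (1 + X) ^ (m + 1) : ℝ[X]).coeff N := by
  simp only [coeff_X_pow_mul', coeff_one_add_X_pow]
  rcases lt_trichotomy N i with h | rfl | h
  · rw [if_neg (by omega), if_neg (by omega)]; simp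
  · simp
  · obtain ⟨r, rfl⟩ := Nat.exists_eq_add_of_lt h
    rw [if_pos (by omega), if_pos (by omega), show i + r + 1 - (i + 1) = r by omega,
      show i + r + 1 - i = r + 1 by omega]
    have := Nat.add_one_mul_choose_eq m r
    have h2 : ((m : ℝ) + 1) * (m.choose r : ℝ) = ((m + 1).choose (r + 1) : ℝ) * (r + 1) := by
      exact_mod_cast this
    rw [h2]
    push_cast
    ring

lemma coeff_X_pow_succ_mul_one_add_X_pow' (N m i : ℕ) (hN : N ≤ m) :
    ((m : ℝ) - N + i + 1) * (X ^ (i + 1) * (1 + X) ^ m : ℝ[X]).coeff N =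
      ((N : ℝ) - i) * (X ^ i * (1 + X) ^ m : ℝ[X]).coeff N := by
  simp only [coeff_X_pow_mul', coeff_one_add_X_pow]
  rcases lt_trichotomy N i with h | rfl | h
  · rw [if_neg (by omega), if_neg (by omega)]; simp
  · simp
  · obtain ⟨r, rfl⟩ := Nat.exists_eq_add_of_lt h
    rw [if_pos (by omega), if_pos (by omega), show i + r + 1 - (i + 1) = r by omega,
      show i + r + 1 - i = r + 1 by omega]
    have := Nat.choose_succ_right_eq m r
    have h2 : (m.choose (r + 1) : ℝ) * ((r : ℝ) + 1) = m.choose r * ((m : ℝ) - r) := by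
      rw [← Nat.cast_sub (by omega)]
      exact_mod_cast this
    push_cast
    linear_combination -h2

/-- The three coefficients as rational multiples of the binomial coefficient `5N + 5` over `N`. -/
lemma coeff_momentPolynomial (N : ℕ) :
    (momentPolynomial N 0).coeff N =
        ((5 * N + 5).choose N : ℝ) * (3 + 2 * N / (4 * N + 6)) ∧
      (momentPolynomial N 1).coeff N = ((5 * N + 5).choose N : ℝ) *
        ((2 * N + 2) * (N / (5 * N + 5)) * (3 + 2 * (N - 1) / (4 * N + 6)) +
          2 * (1 + N / (4 * N + 6))) ∧
      (momentPolynomial N 2).coeff N = ((5 * N + 5).choose N : ℝ) *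
        ((2 * N + 2) * (2 * N + 1) / 2 * (N / (5 * N + 5)) * ((N - 1) / (5 * N + 4)) *
          (3 + 2 * (N - 2) / (4 * N + 6)) + 2 * (2 * N + 2) * (N / (4 * N + 6))) := by
  have hD : ((1 + X) ^ (5 * N + 5) : ℝ[X]).coeff N = (5 * N + 5).choose N :=
    coeff_one_add_X_pow ℝ _ _
  have a1 := coeff_X_pow_succ_mul_one_add_X_pow' N (5 * N + 5) 0 (by omega)
  have b1 := coeff_X_pow_succ_mul_one_add_X_pow N (5 * N + 4) 0
  have b2 := coeff_X_pow_succ_mul_one_add_X_pow' N (5 * N + 4) 1 (by omega)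
  have c2 := coeff_X_pow_succ_mul_one_add_X_pow N (5 * N + 3) 1
  have c3 := coeff_X_pow_succ_mul_one_add_X_pow' N (5 * N + 3) 2 (by omega)
  simp only [pow_zero, one_mul, zero_add, pow_one, hD, Nat.reduceAdd] at a1 b1 b2 c2 c3
  push_cast at a1 b1 b2 c2 c3
  set D : ℝ := ((5 * N + 5).choose N : ℝ)
  have p1 : (4 * N + 6 : ℝ) ≠ 0 := by positivity
  have p2 : (5 * N + 5 : ℝ) ≠ 0 := by positivity
  have p3 : (5 * N + 4 : ℝ) ≠ 0 := by positivity
  have a1' : (X * (1 + X) ^ (5 * N + 5) : ℝ[X]).coeff N = D * (N / (4 * N + 6)) := by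
    field_simp; linear_combination a1
  have b1' : (X * (1 + X) ^ (5 * N + 4) : ℝ[X]).coeff N = D * (N / (5 * N + 5)) := by
    field_simp; linear_combination b1
  have b2' : (X ^ 2 * (1 + X) ^ (5 * N + 4) : ℝ[X]).coeff N =
      D * (N / (5 * N + 5)) * ((N - 1) / (4 * N + 6)) := by
    rw [← b1']; field_simp; linear_combination b2
  have c2' : (X ^ 2 * (1 + X) ^ (5 * N + 3) : ℝ[X]).coeff N =
      D * (N / (5 * N + 5)) * ((N - 1) / (5 * N + 4)) := by
    rw [← b1']; field_simp; linear_combination c2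
  have c3' : (X ^ 3 * (1 + X) ^ (5 * N + 3) : ℝ[X]).coeff N =
      D * (N / (5 * N + 5)) * ((N - 1) / (5 * N + 4)) * ((N - 2) / (4 * N + 6)) := by
    rw [← c2']; field_simp; linear_combination c3
  have hch : ((2 * N + 2).choose 2 : ℝ) = (2 * N + 2) * (2 * N + 1) / 2 := by
    rw [Nat.cast_choose_two]; push_cast; ring
  refine ⟨?_, ?_, ?_⟩
  · have : momentPolynomial N 0 =
        C (3 : ℝ) * (1 + X) ^ (5 * N + 5) + C (2 : ℝ) * (X * (1 + X) ^ (5 * N + 5)) := by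
      simp only [momentPolynomial, map_ofNat]; ring
    rw [this, coeff_add, coeff_C_mul, coeff_C_mul, hD, a1']
    ring
  · have : momentPolynomial N 1 = C (2 * N + 2 : ℝ) * (C (3 : ℝ) * (X * (1 + X) ^ (5 * N + 4)) +
        C (2 : ℝ) * (X ^ 2 * (1 + X) ^ (5 * N + 4))) +
        C (2 : ℝ) * ((1 + X) ^ (5 * N + 5) + X * (1 + X) ^ (5 * N + 5)) := by
      simp only [momentPolynomial, map_ofNat, map_add, map_mul, map_natCast]; ring
    rw [this]
    simp only [coeff_add, coeff_C_mul, hD, a1', b1', b2']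
    ring
  · have : momentPolynomial N 2 = C ((2 * N + 2).choose 2 : ℝ) *
        (C (3 : ℝ) * (X ^ 2 * (1 + X) ^ (5 * N + 3)) +
          C (2 : ℝ) * (X ^ 3 * (1 + X) ^ (5 * N + 3))) +
        C (2 * (2 * N + 2) : ℝ) * (X * (1 + X) ^ (5 * N + 5)) := by
      simp only [momentPolynomial, map_ofNat, map_add, map_mul, map_natCast]; ring
    rw [this]
    simp only [coeff_add, coeff_C_mul, a1', c2', c3', hch]
    ring

end Moments

/-! ### Variance and covariance -/

namespace KNoncrossingTree

instance (k n : ℕ) : DiscreteMeasurableSpace (KNoncrossingTree k n) := ⟨fun _ => trivial⟩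

lemma integral_uniform (k n : ℕ) (f : KNoncrossingTree k n → ℝ) :
    ∫ T, f T ∂uniform k n = (∑ T, f T) / Fintype.card (KNoncrossingTree k n) := by
  rw [uniform, integral_fintype .of_finite, Finset.sum_div]
  refine Finset.sum_congr rfl fun T _ => ?_
  rw [Measure.real, uniformOn_univ, Measure.count_singleton, smul_eq_mul, ENNReal.toReal_div]
  simp
  ring

lemma labelCount_one (n : ℕ) (T : KNoncrossingTree 2 n) :
    labelCount 1 T = n - labelCount 2 T := by
  rw [eq_sub_iff_add_eq, labelCount, labelCount, ← Nat.cast_add]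
  have : (Finset.univ.filter fun v : Fin n => (T.label v : ℕ) = 2) =
      Finset.univ.filter fun v : Fin n => ¬ (T.label v : ℕ) = 1 := by
    refine Finset.filter_congr fun v _ => ?_
    have := Finset.mem_Icc.1 (T.label v).2
    omega
  rw [this, Finset.card_filter_add_card_filter_not, Finset.card_univ, Fintype.card_fin]

/-- The number of `2`-noncrossing trees with `N + 2` vertices, and the sums of `X₂` and of `X₂ ^ 2`
over them. -/
lemma card_and_moments (N : ℕ) :
    ((N : ℝ) + 1) * Fintype.card (KNoncrossingTree 2 (N + 2)) =
        (momentPolynomial N 0).coeff N ∧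
      ((N : ℝ) + 1) * ∑ T : KNoncrossingTree 2 (N + 2), labelCount 2 T =
        (momentPolynomial N 1).coeff N ∧
      ((N : ℝ) + 1) * ∑ T : KNoncrossingTree 2 (N + 2), labelCount 2 T ^ 2 =
        2 * (momentPolynomial N 2).coeff N + (momentPolynomial N 1).coeff N := by
  refine ⟨?_, ?_, ?_⟩
  · simp [← sum_choose_eq N (i := 0) (by norm_num)]
  · simp [← sum_choose_eq N (i := 1) (by norm_num), labelCount]
  · rw [← sum_choose_eq N (i := 1) (by norm_num), ← sum_choose_eq N (i := 2) (by norm_num),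
      mul_left_comm, ← mul_add, Finset.mul_sum _ _ (2 : ℝ), ← Finset.sum_add_distrib]
    refine congrArg _ (Finset.sum_congr rfl fun T _ => ?_)
    rw [Nat.cast_choose_two, Nat.choose_one_right, labelCount]
    ring

lemma card_pos (N : ℕ) : (0 : ℝ) < Fintype.card (KNoncrossingTree 2 (N + 2)) := by
  have h := (card_and_moments N).1
  rw [(coeff_momentPolynomial N).1] at h
  have hD : (0 : ℝ) < ((5 * N + 5).choose N : ℝ) := by
    exact_mod_cast Nat.choose_pos (by omega)
  have : 0 < ((N : ℝ) + 1) * Fintype.card (KNoncrossingTree 2 (N + 2)) := by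
    rw [h]; positivity
  exact pos_of_mul_pos_right this (by positivity)

lemma isProbabilityMeasure_uniform (N : ℕ) : IsProbabilityMeasure (uniform 2 (N + 2)) := by
  have : Nonempty (KNoncrossingTree 2 (N + 2)) :=
    Fintype.card_pos_iff.1 (by exact_mod_cast card_pos N)
  exact isProbabilityMeasure_uniformOn' Set.finite_univ Set.univ_nonempty MeasurableSet.univ

lemma variance_labelCount_two (N : ℕ) :
    variance (labelCount 2) (uniform 2 (N + 2)) =
      3 * (2 * N + 3) * (4 * N + 5) * (49 * N ^ 2 + 96 * N + 40) /
        (25 * (5 * N + 4) * (7 * N + 9) ^ 2) := by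
  have := isProbabilityMeasure_uniform N
  obtain ⟨h0, h1, h2⟩ := card_and_moments N
  obtain ⟨m0, m1, m2⟩ := coeff_momentPolynomial N
  rw [m0] at h0
  rw [m1] at h1
  rw [m1, m2] at h2
  have hD : (0 : ℝ) < ((5 * N + 5).choose N : ℝ) := by
    exact_mod_cast Nat.choose_pos (by omega)
  rw [variance_eq_sub .of_discrete]
  simp only [Pi.pow_apply]
  rw [integral_uniform, integral_uniform]
  have hM : (N : ℝ) + 1 ≠ 0 := by positivity
  rw [← mul_div_mul_left _ _ hM, ← mul_div_mul_left (∑ T, labelCount 2 T) _ hM, h0, h1, h2]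
  -- in this form the denominator visibly does not vanish
  have q : (3 + 2 * N / (4 * N + 6) : ℝ) = 2 * (7 * N + 9) / (4 * N + 6) := by
    field_simp; ring
  rw [q]
  set D : ℝ := ((5 * N + 5).choose N : ℝ)
  have p0 : (7 * N + 9 : ℝ) ≠ 0 := by positivity
  have p1 : (4 * N + 6 : ℝ) ≠ 0 := by positivity
  have p2 : (5 * N + 5 : ℝ) ≠ 0 := by positivity
  have p3 : (5 * N + 4 : ℝ) ≠ 0 := by positivity
  field_simp
  ring

end KNoncrossingTree

theorem mainTheorem11 (n : ℕ) (hn : 1 < n) :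
    variance (KNoncrossingTree.labelCount 1) (KNoncrossingTree.uniform 2 n) =
      (3 * (2 * (n : ℝ) - 1) * (4 * (n : ℝ) - 3) * (49 * (n : ℝ) ^ 2 - 100 * (n : ℝ) + 44) /
        (25 * (5 * (n : ℝ) - 6) * (7 * (n : ℝ) - 5) ^ 2)) ∧
    variance (KNoncrossingTree.labelCount 2) (KNoncrossingTree.uniform 2 n) =
      (3 * (2 * (n : ℝ) - 1) * (4 * (n : ℝ) - 3) * (49 * (n : ℝ) ^ 2 - 100 * (n : ℝ) + 44) /
        (25 * (5 * (n : ℝ) - 6) * (7 * (n : ℝ) - 5) ^ 2)) ∧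
    covariance (KNoncrossingTree.labelCount 1) (KNoncrossingTree.labelCount 2)
        (KNoncrossingTree.uniform 2 n) =
      -(3 * (2 * (n : ℝ) - 1) * (4 * (n : ℝ) - 3) * (49 * (n : ℝ) ^ 2 - 100 * (n : ℝ) + 44) /
        (25 * (5 * (n : ℝ) - 6) * (7 * (n : ℝ) - 5) ^ 2)) ∧
    covariance (KNoncrossingTree.labelCount 2) (KNoncrossingTree.labelCount 1)
        (KNoncrossingTree.uniform 2 n) =
      -(3 * (2 * (n : ℝ) - 1) * (4 * (n : ℝ) - 3) * (49 * (n : ℝ) ^ 2 - 100 * (n : ℝ) + 44) /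
        (25 * (5 * (n : ℝ) - 6) * (7 * (n : ℝ) - 5) ^ 2)) := by
  obtain ⟨N, rfl⟩ := Nat.exists_eq_add_of_le' hn
  have := KNoncrossingTree.isProbabilityMeasure_uniform N
  have h1 : (KNoncrossingTree.labelCount 1 : KNoncrossingTree 2 (N + 2) → ℝ) =
      fun T => ((N + 2 : ℕ) : ℝ) - KNoncrossingTree.labelCount 2 T :=
    funext (KNoncrossingTree.labelCount_one (N + 2))
  have hV : variance (KNoncrossingTree.labelCount 2) (KNoncrossingTree.uniform 2 (N + 2)) =
      3 * (2 * ((N + 2 : ℕ) : ℝ) - 1) * (4 * ((N + 2 : ℕ) : ℝ) - 3) *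
        (49 * ((N + 2 : ℕ) : ℝ) ^ 2 - 100 * ((N + 2 : ℕ) : ℝ) + 44) /
        (25 * (5 * ((N + 2 : ℕ) : ℝ) - 6) * (7 * ((N + 2 : ℕ) : ℝ) - 5) ^ 2) := by
    rw [KNoncrossingTree.variance_labelCount_two]
    push_cast
    congr 1 <;> ring
  have hC : covariance (KNoncrossingTree.labelCount 1) (KNoncrossingTree.labelCount 2)
      (KNoncrossingTree.uniform 2 (N + 2)) =
      -variance (KNoncrossingTree.labelCount 2) (KNoncrossingTree.uniform 2 (N + 2)) := by
    rw [h1, covariance_const_sub_left .of_finite, covariance_self (.of_discrete)]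
  refine ⟨?_, hV, ?_, ?_⟩
  · rw [h1, variance_const_sub .of_discrete, hV]
  · rw [hC, hV]
  · rw [covariance_comm, hC, hV]
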